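/- All systems are finite dimensional, and a channel is a completely positive trace-preserving map. For a channel $\Theta$ and a set $\mathcal F$ of channels with the same input and output systems, the generalised robustness is $$\mathcal R(\Theta|\mathcal F)=\inf\Big\{r\ge 0\;:\;\frac{\Theta+r\Lambda}{1+r}\in\mathcal F\text{ for some channel }\Lambda\Big\}\in[0,\infty],\qquad \inf\emptyset=\infty .$$ Let $M\ge 1$. An ensemble of branches of a quantum comb with $M$ slots, $\{p_j,\Xi_j\}_{j=1}^N$, consists of a probability vector $(p_j)$ and of a circuit: a state $\zeta_0$ on an ancilla and the input of the first slot is prepared; between slot $k$ and slot $k+1$ a channel $\mathcal N_k$ acts on ancilla and system (the ancillas are arbitrary and may change from slot to slot); and after slot $M$ the ancilla and the output are measured with a POVM $\{\mathbb N_j\}_{j=1}^N$. When the slots are filled with channels $\Lambda_1,\dots,\Lambda_M$, the number $\Xi_j[\Lambda_1,\dots,\Lambda_M]$ is the probability of outcome $j$, and the success probability is $P_s(\{p_j,\Xi_j\},\{\Lambda_k\})=\sum_j p_j\,\Xi_j[\Lambda_1,\dots,\Lambda_M]$. **General statement.** Let $\mathcal F_1,\dots,\mathcal F_M$ be nonempty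 convex sets of channels and $\Theta_1,\dots,\Theta_M$ channels, where $\Theta_k$ and the elements of $\mathcal F_k$ have the same input and output systems, namely those of slot $k$. Then $$\max_{\{p_j,\Xi_j\}}\frac{P_s(\{p_j,\Xi_j\},\{\Theta_k\})}{\sup_{\Phi_k\in\mathcal F_k}P_s(\{p_j,\Xi_j\},\{\Phi_k\})}=\prod_{k=1}^M\big(1+\mathcal R(\Theta_k|\mathcal F_k)\big),$$ where both sides may be $+\infty$, the maximum over all ensembles is attained, $x/0=\infty$ for $x>0$, and ensembles with the indeterminate ratio $0/0$ are disregarded. If all $\mathcal F_k$ are closed, the supremum over free channels is attained for every ensemble, and the infimum that defines $\mathcal R(\Theta_k|\mathcal F_k)$ is attained whenever it is finite. **Star resource theories.** Represent the channels between two fixed systems in $\mathbb R^d$ by a map that is affine and injective on channels. Let $\mathcal F\subset\mathbb R^d$ be a compact star domain consisting of (represented) channels, with kernel $\mathrm{Ker}(\mathcal F)$ (the set of its centers). A fortress of $\mathcal F$ is a family of convex cones, each of which meets $\mathcal F$, which together with $\mathcal F$ cover $\mathbb R^d$, such that $\mathcal F$ lies in the complement of the interior of each cone, $\mathrm{Ker}(\mathcal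 F)$ lies in the reflection of each cone through its apex, and $\partial\mathcal F$ is the union of the intersections of the cones with $\mathcal F$. Let $\mathcal C$ be a cone of a fortress of $\mathcal F$. The free sections of $\mathcal C$ are obtained as follows: among the convex components (maximal convex subsets) of $\mathcal F$ keep those whose intersection with $\mathcal C$ is inclusion-maximal; each free section is the intersection of all kept components that share one and the same intersection with $\mathcal C$. Suppose that there are finitely many free sections $\mathcal F_1,\dots,\mathcal F_M$, and let $\Theta$ be a channel in the domain $\mathcal D=\mathcal C\cup\bigcup_k\mathcal F_k$. Then $$\max_{\{p_j,\Xi_j\}}\frac{P_s(\{p_j,\Xi_j\},\{\Theta,\dots,\Theta\})}{\max_{\Phi_k\in\mathcal F_k}P_s(\{p_j,\Xi_j\},\{\Phi_k\})}=\prod_{k=1}^M\big(1+\mathcal R(\Theta|\mathcal F_k)\big),$$ with the same conventions, where the maximum over free channels is attained for every ensemble, and the infimum that defines $\mathcal R(\Theta|\mathcal F_k)$ is attained whenever it is finite. -/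

import Mathlib

open scoped ENNReal ComplexOrder

noncomputable section

namespace StarQRT

/-! ## Channels on finite-dimensional systems

A quantum system with a fixed orthonormal basis indexed by a finite type `A` has operators
`Matrix A A ℂ`; a composite system is indexed by a product type. -/

/-- Linear maps from operators on the system `A` to operators on the system `B`. -/
abbrev Superop (A B : Type) : Type := Matrix A A ℂ →ₗ[ℂ] Matrix B B ℂ

/-- The map `id_R ⊗ Φ`, acting on operators of the composite system `R ⊗ A`. -/
def idTensor (R : Type) {A B : Type} (Φ : Superop A B) : Superop (R × A) (R × B) where
  toFun X := Matrix.of fun i j => Φ (Matrix.of fun a a' => X (i.1, a) (j.1, a')) i.2 j.2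
  map_add' X Y := by
    ext i j
    exact congrFun (congrFun (map_add Φ (Matrix.of fun a a' => X (i.1, a) (j.1, a'))
      (Matrix.of fun a a' => Y (i.1, a) (j.1, a'))) i.2) j.2
  map_smul' c X := by
    ext i j
    exact congrFun (congrFun (map_smul Φ c (Matrix.of fun a a' => X (i.1, a) (j.1, a'))) i.2) j.2

/-- Complete positivity: `id_R ⊗ Φ` preserves positive semidefiniteness for every finite `R`. -/
def IsCP {A B : Type} (Φ : Superop A B) : Prop :=
  ∀ (R : Type) [Fintype R] (X : Matrix (R × A) (R × A) ℂ),
    X.PosSemidef → (idTensor R Φ X).PosSemidef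

/-- Quantum channels: completely positive and trace preserving maps. -/
structure IsChannel {A B : Type} [Fintype A] [Fintype B] (Φ : Superop A B) : Prop where
  cp : IsCP Φ
  trace_eq : ∀ X : Matrix A A ℂ, (Φ X).trace = X.trace

/-- The Choi matrix of `Φ` (the Jamiołkowski state up to normalisation). -/
def choi {A B : Type} [DecidableEq A] (Φ : Superop A B) : Matrix (A × B) (A × B) ℂ :=
  Matrix.of fun i j => Φ (Matrix.single i.1 j.1 1) i.2 j.2

/-! ## Generalised robustness -/

/-- The admissible mixing weights: all `r ≥ 0` such that `(Θ + r Λ) / (1 + r) ∈ F` for some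
channel `Λ`. -/
def robustnessSet {A B : Type} [Fintype A] [Fintype B] (Θ : Superop A B)
    (F : Set (Superop A B)) : Set ℝ≥0∞ :=
  {x | ∃ r : ℝ, 0 ≤ r ∧ x = ENNReal.ofReal r ∧
    ∃ Λ : Superop A B, IsChannel Λ ∧ (1 + r)⁻¹ • (Θ + r • Λ) ∈ F}

/-- Generalised robustness `R(Θ | F)`; it is `∞` if no weight is admissible. -/
def robustness {A B : Type} [Fintype A] [Fintype B] (Θ : Superop A B)
    (F : Set (Superop A B)) : ℝ≥0∞ :=
  sInf (robustnessSet Θ F)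

/-! ## Branch ensembles of quantum combs with `M = m + 1` slots -/

/-- An ensemble `{p_j, Ξ_j}` of branches of a quantum comb with classical output: probabilities
`p_j`, and a circuit that prepares a state of ancilla and first slot input, applies a channel
between any two consecutive slots, and measures ancilla and last slot output with a POVM
whose outcome `j` identifies the branch `Ξ_j`.  The slot `k` accepts channels from `A k` to `B k`,
and `Anc k` is the ancilla that bypasses it. -/
structure BranchEnsemble {m : ℕ} (A B : Fin (m + 1) → Type)
    [∀ k, Fintype (A k)] [∀ k, Fintype (B k)] [∀ k, DecidableEq (B k)] where
  /-- the number of branches -/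
  N : ℕ
  p : Fin N → ℝ
  p_nonneg : ∀ j, 0 ≤ p j
  p_sum : ∑ j, p j = 1
  Anc : Fin (m + 1) → Type
  [ancFintype : ∀ k, Fintype (Anc k)]
  [ancDecEq : ∀ k, DecidableEq (Anc k)]
  /-- the initial state -/
  state : Matrix (Anc 0 × A 0) (Anc 0 × A 0) ℂ
  state_pos : state.PosSemidef
  state_trace : state.trace = 1
  /-- the channel between slot `k` and slot `k + 1` -/
  chan : ∀ k : Fin m, Superop (Anc k.castSucc × B k.castSucc) (Anc k.succ × A k.succ)
  chan_isChannel : ∀ k, IsChannel (chan k)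
  /-- the final measurement -/
  povm : Fin N → Matrix (Anc (Fin.last m) × B (Fin.last m)) (Anc (Fin.last m) × B (Fin.last m)) ℂ
  povm_pos : ∀ j, (povm j).PosSemidef
  povm_sum : ∑ j, povm j = 1

attribute [instance] BranchEnsemble.ancFintype BranchEnsemble.ancDecEq

namespace BranchEnsemble

variable {m : ℕ} {A B : Fin (m + 1) → Type}
  [∀ k, Fintype (A k)] [∀ k, Fintype (B k)] [∀ k, DecidableEq (B k)]

/-- The operator on ancilla and input of slot `k`, when the slots are filled with `Λ`. -/
def stateBefore (G : BranchEnsemble A B) (Λ : ∀ k, Superop (A k) (B k)) :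
    ∀ k : Fin (m + 1), Matrix (G.Anc k × A k) (G.Anc k × A k) ℂ :=
  Fin.induction G.state
    fun k σ => G.chan k (idTensor (G.Anc k.castSucc) (Λ k.castSucc) σ)

/-- The output `Ξ_j[Λ]` of the branch `j`: the probability of the outcome `j` when the slots are
filled with `Λ`. -/
def branch (G : BranchEnsemble A B) (j : Fin G.N) (Λ : ∀ k, Superop (A k) (B k)) : ℝ :=
  (G.povm j * idTensor (G.Anc (Fin.last m)) (Λ (Fin.last m))
    (G.stateBefore Λ (Fin.last m))).trace.re

/-- The success probability `∑ j, p_j Ξ_j[Λ]`. -/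
def successProb (G : BranchEnsemble A B) (Λ : ∀ k, Superop (A k) (B k)) : ℝ :=
  ∑ j, G.p j * G.branch j Λ

/-- The best success probability when slot `k` is filled with an element of `F k`. -/
def freeValue (G : BranchEnsemble A B) (F : ∀ k, Set (Superop (A k) (B k))) : ℝ≥0∞ :=
  ⨆ (Φ : ∀ k, Superop (A k) (B k)) (_ : ∀ k, Φ k ∈ F k), ENNReal.ofReal (G.successProb Φ)

/-- The ratio of the success probability with the resources `Θ` to the best free one.  It is `∞`
if only the denominator vanishes; an indeterminate `0 / 0` is `0` here, and so never exceeds the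
ratio `1` of a trivial ensemble. -/
def advantage (G : BranchEnsemble A B) (F : ∀ k, Set (Superop (A k) (B k)))
    (Θ : ∀ k, Superop (A k) (B k)) : ℝ≥0∞ :=
  ENNReal.ofReal (G.successProb Θ) / G.freeValue F

/-- The best free success probability is attained. -/
def FreeMaxAttained (G : BranchEnsemble A B) (F : ∀ k, Set (Superop (A k) (B k))) : Prop :=
  ∃ Φ : ∀ k, Superop (A k) (B k), (∀ k, Φ k ∈ F k) ∧
    ∀ Ψ : ∀ k, Superop (A k) (B k), (∀ k, Ψ k ∈ F k) → G.successProb Ψ ≤ G.successProb Φ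

end BranchEnsemble

/-! ## Star domains, fortresses, free sections -/

/-- The kernel of `K`: the set of all its centers. -/
def kernel {V : Type*} [AddCommGroup V] [Module ℝ V] (K : Set V) : Set V :=
  {x | x ∈ K ∧ StarConvex ℝ x K}

/-- Star domains: sets with at least one center. -/
def IsStarDomain {V : Type*} [AddCommGroup V] [Module ℝ V] (K : Set V) : Prop :=
  (kernel K).Nonempty

/-- The convex components of `K`: its inclusion-maximal convex subsets. -/
def convexComponents {V : Type*} [AddCommGroup V] [Module ℝ V] (K : Set V) : Set (Set V) :=
  {S | Maximal (fun T : Set V => Convex ℝ T ∧ T ⊆ K) S}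

/-- `C` is a cone with apex `v`. -/
def IsApex {V : Type*} [AddCommGroup V] [Module ℝ V] (C : Set V) (v : V) : Prop :=
  ∀ c ∈ C, ∀ t : ℝ, 0 < t → v + t • (c - v) ∈ C

/-- A fortress of `K`: a collection of convex cones that together with `K` cover the space, have
`K` in their exteriors (complements of interiors), have the kernel of `K` in their reflections
through the apex, and meet `K`, with all intersections together forming the boundary of `K`. -/
structure IsFortress {V : Type*} [AddCommGroup V] [Module ℝ V] [TopologicalSpace V]
    (K : Set V) (T : Set (Set V)) : Prop where
  convex : ∀ C ∈ T, Convex ℝ C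
  cover : K ∪ ⋃₀ T = Set.univ
  exterior : ∀ C ∈ T, K ⊆ (interior C)ᶜ
  apex_refl : ∀ C ∈ T, ∃ v, IsApex C v ∧ ∀ w ∈ kernel K, v + (v - w) ∈ C
  boundary : frontier K = ⋃ C ∈ T, C ∩ K
  meets : ∀ C ∈ T, (C ∩ K).Nonempty

/-- Redundancy deletion of the collection `𝔄` through `K`: the members of `𝔄` whose intersection
with `K` is maximal. -/
def redundancyDeletion {V : Type*} (K : Set V) (𝔄 : Set (Set V)) : Set (Set V) :=
  {S | S ∈ 𝔄 ∧ ∀ T ∈ 𝔄, S ∩ K ⊆ T ∩ K → T ∩ K ⊆ S ∩ K}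

/-- The free sections of `K` selected by the cone `C`: for each maximal intersection of `C` with a
convex component of `K`, the intersection of all convex components sharing it. -/
def freeSections {V : Type*} [AddCommGroup V] [Module ℝ V] (K C : Set V) : Set (Set V) :=
  {S | ∃ P ∈ redundancyDeletion C (convexComponents K),
    S = ⋂₀ {Q | Q ∈ redundancyDeletion C (convexComponents K) ∧ Q ∩ C = P ∩ C}}

end StarQRT

end

/-! Upper bound. An admissible weight `r k` yields `Φ k ∈ F k` with `(1 + r k) • Φ k - Θ k`
completely positive. A circuit built from completely positive maps preserves such an order: each
slot multiplies the bound on the running state by `1 + r k`, so the success probability with `Θ` is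
at most `∏ (1 + r k)` times the one with `Φ` (`successProb_le_prod_mul`). Infima over the weights
give `advantage_le`.

Lower bound. In terms of Choi matrices, `1 + R(Θ | F)` is the least `l` with `choi Θ ≤ l • choi Φ`,
`Φ ∈ F`. Conic duality (`exists_dual_witness`) provides a positive `W` whose pairing with `choi Θ`
is at least `1 + R` times its pairing with every `choi Φ`. The dual optimum is attained even when
`F` is not closed: all of `F` lives on the support of one member `E` of maximal support. If `choi Θ`
leaves that support, the complementary projection separates and the ratio is infinite; otherwise `E`
acts as an order unit after compression, the gauge `X ↦ inf l` is finite and sublinear, and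
Hahn–Banach yields `W`.

The witnesses of the slots are then tested one after another (`exists_ensemble_of_witnesses`). Each
slot receives half of a maximally entangled state, and a rescaled `W k` is the effect that must
occur. A failed test raises a flag that makes all later tests fail, so the success probability
factorises into the single-slot pairings.

Attainment for closed sets follows from compactness of the set of Choi matrices of channels. For
star domains it remains to see that free sections are nonempty, convex and closed: each is an
intersection of convex components, all of which contain the kernel. -/

open scoped ENNReal ComplexOrder Matrix

noncomputable section

namespace StarQRT

/-! ### Positive semidefinite matrices, supports and positive functionals -/

section MatrixOrder

variable {n : Type*} [Fintype n]

theorem posSemidef_smul_real {n : Type*} {X : Matrix n n ℂ} (hX : X.PosSemidef) {t : ℝ} (ht : 0 ≤ t) :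
    (t • X).PosSemidef :=
  hX.smul ht

theorem IsHermitian.exists_diagonal [DecidableEq n] {X : Matrix n n ℂ} (hX : X.IsHermitian) :
    ∃ (U : Matrix n n ℂ) (d : n → ℝ), U * Uᴴ = 1 ∧ Uᴴ * U = 1 ∧
      X = U * Matrix.diagonal (fun i => (d i : ℂ)) * Uᴴ := by
  refine ⟨hX.eigenvectorUnitary, hX.eigenvalues, ?_, ?_, ?_⟩
  · exact Unitary.coe_mul_star_self _
  · exact Unitary.coe_star_mul_self _
  · conv_lhs => rw [hX.spectral_theorem, Unitary.conjStarAlgAut_apply]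
    rfl

theorem posSemidef_conj_diagonal [DecidableEq n] (U : Matrix n n ℂ) {d : n → ℝ}
    (hd : ∀ i, 0 ≤ d i) :
    (U * Matrix.diagonal (fun i => (d i : ℂ)) * Uᴴ).PosSemidef :=
  (Matrix.PosSemidef.diagonal fun i => by simpa using hd i).mul_mul_conjTranspose_same U

theorem exists_smul_one_sub_posSemidef [DecidableEq n] {X : Matrix n n ℂ} (hX : X.IsHermitian) :
    ∃ t : ℝ, 0 < t ∧ (t • (1 : Matrix n n ℂ) - X).PosSemidef := by
  obtain ⟨U, d, hU, -, rfl⟩ := IsHermitian.exists_diagonal hX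
  have hs : 0 ≤ ∑ j, |d j| := Finset.sum_nonneg fun j _ => abs_nonneg _
  refine ⟨1 + ∑ j, |d j|, by positivity, ?_⟩
  have h := posSemidef_conj_diagonal U (d := fun i => 1 + ∑ j, |d j| - d i) fun i => by
    have := Finset.single_le_sum (f := fun j => |d j|) (fun j _ => abs_nonneg _)
      (Finset.mem_univ i)
    have := le_abs_self (d i)
    linarith
  convert h using 1
  have : Matrix.diagonal (fun i => ((1 + ∑ j, |d j| - d i : ℝ) : ℂ)) =
      (1 + ∑ j, |d j| : ℝ) • (1 : Matrix n n ℂ) - Matrix.diagonal (fun i => (d i : ℂ)) := by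
    ext i j
    by_cases hij : i = j
    · subst hij; simp
    · simp [hij]
  rw [this, Matrix.mul_sub, Matrix.sub_mul, Matrix.mul_smul, Matrix.smul_mul, Matrix.mul_one, hU]

/-- A positive semidefinite matrix dominates a positive multiple of its support projection. -/
theorem exists_support_projection [DecidableEq n] {E : Matrix n n ℂ} (hE : E.PosSemidef) :
    ∃ (P : Matrix n n ℂ) (c : ℝ), P.IsHermitian ∧ P * P = P ∧ E * (1 - P) = 0 ∧ 0 < c ∧
      (E - c • P).PosSemidef := by
  obtain ⟨U, d, hU, hU', hd⟩ := IsHermitian.exists_diagonal hE.1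
  have hd0 : ∀ i, 0 ≤ d i := by
    intro i
    have h := hE.conjTranspose_mul_mul_same U
    have : Uᴴ * E * U = Matrix.diagonal (fun i => (d i : ℂ)) := by
      rw [hd]
      simp only [Matrix.mul_assoc]
      rw [hU', Matrix.mul_one, ← Matrix.mul_assoc, hU', Matrix.one_mul]
    rw [this, Matrix.posSemidef_diagonal_iff] at h
    exact_mod_cast h i
  -- `c` is the smallest nonzero eigenvalue, or `1` if all eigenvalues vanish.
  obtain ⟨c, hc0, hc⟩ : ∃ c : ℝ, 0 < c ∧ ∀ i, d i ≠ 0 → c ≤ d i := by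
    rcases (Finset.univ.filter fun i => d i ≠ 0).eq_empty_or_nonempty with h | h
    · refine ⟨1, one_pos, fun i hi => ?_⟩
      have : i ∈ (Finset.univ.filter fun i => d i ≠ 0) := by simp [hi]
      rw [h] at this
      simp at this
    · obtain ⟨i, hi, hmin⟩ := Finset.exists_min_image _ d h
      refine ⟨d i, lt_of_le_of_ne (hd0 i) (Ne.symm (by simpa using hi)), fun j hj => ?_⟩
      exact hmin j (by simp [hj])
  set q : n → ℝ := fun i => if d i = 0 then 0 else 1 with hq
  set Q : Matrix n n ℂ := Matrix.diagonal (fun i => (q i : ℂ)) with hQ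
  have key : ∀ Y Z : Matrix n n ℂ, U * Y * Uᴴ * (U * Z * Uᴴ) = U * (Y * Z) * Uᴴ := by
    intro Y Z
    calc U * Y * Uᴴ * (U * Z * Uᴴ) = U * Y * (Uᴴ * U) * Z * Uᴴ := by
          simp only [Matrix.mul_assoc]
      _ = _ := by rw [hU']; simp only [Matrix.mul_assoc, Matrix.one_mul]
  refine ⟨U * Q * Uᴴ, c, ?_, ?_, ?_, hc0, ?_⟩
  · exact (posSemidef_conj_diagonal U fun i => by simp only [hq]; split_ifs <;> norm_num).1
  · rw [key, hQ, Matrix.diagonal_mul_diagonal]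
    congr 3
    ext i
    simp only [hq]; split_ifs <;> simp
  · rw [Matrix.mul_sub, Matrix.mul_one, hd, key, hQ, Matrix.diagonal_mul_diagonal, sub_eq_zero]
    congr 3
    ext i
    simp only [hq]; split_ifs with h <;> simp [h]
  · have h := posSemidef_conj_diagonal U (d := fun i => d i - c * q i) fun i => by
      by_cases h : d i = 0
      · simp [hq, h]
      · simpa [hq, h] using hc i h
    convert h using 1
    have : Matrix.diagonal (fun i => ((d i - c * q i : ℝ) : ℂ)) =
        Matrix.diagonal (fun i => (d i : ℂ)) - c • Q := by
      ext i j
      by_cases hij : i = j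
      · subst hij; simp [hQ]
      · simp [hQ, hij]
    rw [this, Matrix.mul_sub, Matrix.sub_mul, Matrix.mul_smul, Matrix.smul_mul, ← hd]

theorem exists_eq_conjTranspose_mul_self [DecidableEq n] {X : Matrix n n ℂ} (hX : X.PosSemidef) :
    ∃ Y : Matrix n n ℂ, X = Yᴴ * Y := by
  open scoped MatrixOrder in
  exact CStarAlgebra.nonneg_iff_eq_star_mul_self.mp hX.nonneg

theorem re_trace_nonneg {X : Matrix n n ℂ} (hX : X.PosSemidef) : 0 ≤ X.trace.re :=
  (Complex.le_def.mp hX.trace_nonneg).1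

theorem PosSemidef.eq_zero_of_re_trace {X : Matrix n n ℂ} (hX : X.PosSemidef)
    (h : X.trace.re ≤ 0) : X = 0 := by
  rw [← hX.trace_eq_zero_iff]
  have := Complex.le_def.mp hX.trace_nonneg
  exact Complex.ext (le_antisymm h this.1) (by simpa using this.2.symm)

theorem re_trace_mul_nonneg {X Y : Matrix n n ℂ} (hX : X.PosSemidef) (hY : Y.PosSemidef) :
    0 ≤ (X * Y).trace.re := by
  classical
  obtain ⟨Z, rfl⟩ := exists_eq_conjTranspose_mul_self hX
  rw [Matrix.mul_assoc, Matrix.trace_mul_comm]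
  exact re_trace_nonneg (hY.mul_mul_conjTranspose_same Z)

/-- In a convex set of positive semidefinite matrices some member has the smallest kernel. -/
theorem exists_maximal_support {S : Set (Matrix n n ℂ)} (hne : S.Nonempty) (hconv : Convex ℝ S)
    (hpos : ∀ X ∈ S, X.PosSemidef) :
    ∃ E ∈ S, ∀ X ∈ S, ∀ v, E.mulVec v = 0 → X.mulVec v = 0 := by
  let k : Matrix n n ℂ → ℕ := fun X => Module.finrank ℂ (LinearMap.ker X.mulVecLin)
  -- Kernel dimensions are natural numbers, so a minimiser exists. The midpoint of `E` and `X` lies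
  -- in `S` and its kernel is contained in both kernels; minimality forces it to equal `ker E`.
  refine ⟨Function.argminOn k S hne, Function.argminOn_mem _ _ _, fun X hX => ?_⟩
  have hE := Function.argminOn_mem k S hne
  have hmin : ∀ Z ∈ S, k (Function.argminOn k S hne) ≤ k Z := fun Z hZ =>
    Function.argminOn_le k S hZ
  generalize Function.argminOn k S hne = E at hE hmin
  have hZ : (1 / 2 : ℝ) • E + (1 / 2 : ℝ) • X ∈ S :=
    hconv hE hX (by norm_num) (by norm_num) (by norm_num)
  have hker : ∀ v, ((1 / 2 : ℝ) • E + (1 / 2 : ℝ) • X).mulVec v = 0 →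
      E.mulVec v = 0 ∧ X.mulVec v = 0 := by
    intro v hv
    have h0 := congrArg (fun w => star v ⬝ᵥ w) hv
    simp only [Matrix.add_mulVec, Matrix.smul_mulVec, dotProduct_add, dotProduct_smul,
      dotProduct_zero] at h0
    have h1 := (hpos E hE).dotProduct_mulVec_nonneg v
    have h2 := (hpos X hX).dotProduct_mulVec_nonneg v
    rw [← (hpos E hE).dotProduct_mulVec_zero_iff, ← (hpos X hX).dotProduct_mulVec_zero_iff]
    rw [Complex.le_def] at h1 h2
    have h3 := congrArg Complex.re h0
    simp only [Complex.add_re, Complex.smul_re, Complex.zero_re, smul_eq_mul] at h3 h1 h2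
    exact ⟨Complex.ext (by simp only [Complex.zero_re]; linarith) h1.2.symm,
      Complex.ext (by simp only [Complex.zero_re]; linarith) h2.2.symm⟩
  have hle : LinearMap.ker ((1 / 2 : ℝ) • E + (1 / 2 : ℝ) • X).mulVecLin ≤
      LinearMap.ker E.mulVecLin := fun v hv => by
    simp only [LinearMap.mem_ker, Matrix.mulVecLin_apply] at hv ⊢
    exact (hker v hv).1
  have heq := Submodule.eq_of_le_of_finrank_le hle (hmin _ hZ)
  intro v hv
  have : v ∈ LinearMap.ker E.mulVecLin := by simpa using hv
  rw [← heq, LinearMap.mem_ker, Matrix.mulVecLin_apply] at this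
  exact (hker v this).2

theorem mul_eq_zero_of_ker_le [DecidableEq n] {E X Q : Matrix n n ℂ}
    (h : ∀ v, E.mulVec v = 0 → X.mulVec v = 0) (hE : E * Q = 0) : X * Q = 0 := by
  ext i j
  have := h (fun k => Q k j) (by
    ext i
    exact congrFun (congrFun hE i) j)
  exact congrFun this i

/-- Every real functional on complex matrices is `X ↦ re tr (W X)`. -/
theorem exists_trace_representation [DecidableEq n] (g : Matrix n n ℂ →ₗ[ℝ] ℝ) :
    ∃ W : Matrix n n ℂ, ∀ X, g X = (W * X).trace.re := by
  refine ⟨Matrix.of fun j i => (g (Matrix.single i j 1) : ℂ) -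
    Complex.I * (g (Matrix.single i j Complex.I) : ℂ), fun X => ?_⟩
  have hX : X = ∑ i, ∑ j, ((X i j).re • Matrix.single i j (1 : ℂ) +
      (X i j).im • Matrix.single i j Complex.I) := by
    conv_lhs => rw [Matrix.matrix_eq_sum_single X]
    refine Finset.sum_congr rfl fun i _ => Finset.sum_congr rfl fun j _ => ?_
    rw [Matrix.smul_single, Matrix.smul_single, ← Matrix.single_add]
    congr 1
    simp
  conv_lhs => rw [hX]
  simp only [map_sum, map_add, map_smul, smul_eq_mul, Matrix.trace, Matrix.diag, Matrix.mul_apply,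
    Matrix.of_apply, Complex.re_sum]
  rw [Finset.sum_comm]
  refine Finset.sum_congr rfl fun i _ => Finset.sum_congr rfl fun j _ => ?_
  simp
  ring

/-- A real functional that is nonnegative on positive semidefinite matrices and vanishes on
skew-Hermitian ones is represented by a positive semidefinite matrix. -/
theorem posSemidef_of_functional [DecidableEq n] {W : Matrix n n ℂ}
    (hpos : ∀ X : Matrix n n ℂ, X.PosSemidef → 0 ≤ (W * X).trace.re)
    (hskew : ∀ X : Matrix n n ℂ, Xᴴ = -X → (W * X).trace.re = 0) : W.PosSemidef := by
  have hq : ∀ v : n → ℂ, star v ⬝ᵥ W.mulVec v = (W * Matrix.vecMulVec v (star v)).trace := by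
    intro v
    rw [Matrix.mul_vecMulVec, Matrix.trace_vecMulVec, dotProduct_comm]
  have hherm : W.IsHermitian := by
    have hre : ∀ X : Matrix n n ℂ, ((W - Wᴴ) * X).trace.re = 0 := by
      intro X
      -- Since `X - Xᴴ` is skew-Hermitian, `W` pairs equally with `X` and `Xᴴ`. Hence `W - Wᴴ` pairs
      -- to zero with everything, in particular with its own adjoint.
      have h1 := hskew (X - Xᴴ) (by simp)
      have h2 : (Wᴴ * X).trace.re = (W * Xᴴ).trace.re := by
        rw [Matrix.trace_mul_comm W, ← Complex.conj_re (Matrix.trace (Wᴴ * X))]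
        change (star _ : ℂ).re = _
        rw [← Matrix.trace_conjTranspose, Matrix.conjTranspose_mul,
          Matrix.conjTranspose_conjTranspose]
      rw [Matrix.mul_sub, Matrix.trace_sub, Complex.sub_re] at h1
      rw [Matrix.sub_mul, Matrix.trace_sub, Complex.sub_re, h2, h1]
    have h0 := PosSemidef.eq_zero_of_re_trace (Matrix.posSemidef_self_mul_conjTranspose (W - Wᴴ))
      (hre _).le
    rw [Matrix.self_mul_conjTranspose_eq_zero, sub_eq_zero] at h0
    exact h0.symm
  refine Matrix.PosSemidef.of_dotProduct_mulVec_nonneg hherm fun v => ?_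
  have hv := Matrix.posSemidef_vecMulVec_self_star v
  rw [Complex.le_def, hq]
  refine ⟨hpos _ hv, ?_⟩
  -- The real part of the pairing with `i v v*` is minus the imaginary part of the quadratic form at
  -- `v`.
  have := hskew (Complex.I • Matrix.vecMulVec v (star v)) (by
    rw [Matrix.conjTranspose_smul, hv.1.eq]
    simp)
  rw [Matrix.mul_smul, Matrix.trace_smul] at this
  simpa using (Eq.symm (by simpa using this) : (0 : ℝ) = _)

end MatrixOrder

/-! ### The gauge of a convex set and its supporting functional -/

/-- The weights `l ≥ 0` for which `H X ≤ l Y` has a solution `Y ∈ S`. -/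
def dominationWeights {V n : Type*} (H : V → Matrix n n ℂ)
    (S : Set (Matrix n n ℂ)) (X : V) : Set ℝ :=
  {l | 0 ≤ l ∧ ∃ Y ∈ S, (l • Y - H X).PosSemidef}

section Duality

variable {V n : Type*} [AddCommGroup V] [Module ℝ V]
  {H : V →ₗ[ℝ] Matrix n n ℂ} {S : Set (Matrix n n ℂ)}

theorem bddBelow_dominationWeights {V n : Type*} (H : V → Matrix n n ℂ)
    (S : Set (Matrix n n ℂ)) (X : V) : BddBelow (dominationWeights H S X) :=
  ⟨0, fun _ h => h.1⟩

theorem sInf_dominationWeights_nonneg {V n : Type*} (H : V → Matrix n n ℂ)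
    (S : Set (Matrix n n ℂ)) (X : V) : 0 ≤ sInf (dominationWeights H S X) :=
  Real.sInf_nonneg fun _ h => h.1

theorem smul_mem_dominationWeights {X : V} {l c : ℝ} (hc : 0 ≤ c)
    (hl : l ∈ dominationWeights H S X) : c * l ∈ dominationWeights H S (c • X) := by
  obtain ⟨h0, Y, hY, h⟩ := hl
  refine ⟨mul_nonneg hc h0, Y, hY, ?_⟩
  rw [map_smul, mul_smul, ← smul_sub]
  exact posSemidef_smul_real h hc

/-- Convexity of `S` makes the gauge subadditive: `l • Y + l' • Y'` is `l + l'` times a convex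
combination. The case `l + l' = 0` is separate because the coefficients divide by `l + l'`. -/
theorem add_mem_dominationWeights (hconv : Convex ℝ S) {X X' : V} {l l' : ℝ}
    (hl : l ∈ dominationWeights H S X) (hl' : l' ∈ dominationWeights H S X') :
    l + l' ∈ dominationWeights H S (X + X') := by
  obtain ⟨h0, Y, hY, h⟩ := hl
  obtain ⟨h0', Y', hY', h'⟩ := hl'
  have hsum := h.add h'
  rcases eq_or_lt_of_le (add_nonneg h0 h0') with h1 | h1
  · obtain rfl : l = 0 := by linarith
    obtain rfl : l' = 0 := by linarith
    refine ⟨by simp, Y, hY, ?_⟩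
    convert hsum using 1
    rw [map_add]
    simp
    abel
  · refine ⟨h1.le, (l / (l + l')) • Y + (l' / (l + l')) • Y', hconv hY hY' (by positivity)
      (by positivity) (by field_simp), ?_⟩
    convert hsum using 1
    rw [smul_add, smul_smul, smul_smul, mul_div_cancel₀ _ h1.ne', mul_div_cancel₀ _ h1.ne',
      map_add]
    abel

/-- The optimal domination weight is the value at `T` of a functional below all of them. -/
theorem exists_functional_of_dominationWeights (hconv : Convex ℝ S)
    (hfin : ∀ X, (dominationWeights H S X).Nonempty) {T : V} (hT : T ≠ 0) :
    ∃ g : V →ₗ[ℝ] ℝ, g T = sInf (dominationWeights H S T) ∧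
      ∀ X, g X ≤ sInf (dominationWeights H S X) := by
  let N : V → ℝ := fun X => sInf (dominationWeights H S X)
  have hN : ∀ {X l}, l ∈ dominationWeights H S X → N X ≤ l := fun h =>
    csInf_le (bddBelow_dominationWeights _ _ _) h
  have hle : ∀ (c : ℝ), 0 < c → ∀ X, N (c • X) ≤ c * N X := by
    intro c hc X
    rw [← div_le_iff₀' hc]
    refine le_csInf (hfin X) fun l hl => ?_
    rw [div_le_iff₀' hc]
    exact hN (smul_mem_dominationWeights hc.le hl)
  have hhom : ∀ (c : ℝ), 0 < c → ∀ X, N (c • X) = c * N X := by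
    intro c hc X
    refine le_antisymm (hle c hc X) ?_
    have := hle c⁻¹ (inv_pos.mpr hc) (c • X)
    rw [inv_smul_smul₀ hc.ne', ← div_eq_inv_mul, le_div_iff₀' hc] at this
    exact this
  have hadd : ∀ X Y, N (X + Y) ≤ N X + N Y := by
    intro X Y
    rw [← sub_le_iff_le_add]
    refine le_csInf (hfin X) fun l hl => ?_
    rw [sub_le_iff_le_add, ← sub_le_iff_le_add']
    refine le_csInf (hfin Y) fun l' hl' => ?_
    rw [sub_le_iff_le_add']
    exact hN (add_mem_dominationWeights hconv hl hl')
  -- Hahn–Banach, starting from `c • T ↦ c * N T` on the line through `T`. For `c ≤ 0` the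
  -- domination is trivial because `N ≥ 0`.
  obtain ⟨g, hg, hgN⟩ := exists_extension_of_le_sublinear
    (LinearPMap.mkSpanSingleton T (N T) hT) N hhom hadd (by
      rintro ⟨x, hx⟩
      obtain ⟨c, rfl⟩ := Submodule.mem_span_singleton.mp hx
      have h : LinearPMap.mkSpanSingleton T (N T) hT ⟨c • T, hx⟩ = c * N T :=
        LinearPMap.mkSpanSingleton'_apply _ _ _ _ _
      change LinearPMap.mkSpanSingleton T (N T) hT ⟨c • T, hx⟩ ≤ N (c • T)
      rw [h]
      rcases lt_or_ge 0 c with hc | hc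
      · exact (hhom c hc T).ge
      · exact (mul_nonpos_of_nonpos_of_nonneg hc (sInf_dominationWeights_nonneg _ _ _)).trans
          (sInf_dominationWeights_nonneg _ _ _))
  refine ⟨g, ?_, hgN⟩
  rw [hg ⟨T, Submodule.mem_span_singleton_self T⟩]
  exact LinearPMap.mkSpanSingleton_apply ℝ ℝ hT (N T)

end Duality

/-! ### Duality with attained dual optimum -/

section Compression

variable {n : Type*} [Fintype n]

/-- The compression of the Hermitian part of a matrix. -/
def compressRe (P : Matrix n n ℂ) : Matrix n n ℂ →ₗ[ℝ] Matrix n n ℂ where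
  toFun X := (1 / 2 : ℝ) • (P * (X + Xᴴ) * P)
  map_add' X Y := by
    rw [← smul_add, ← Matrix.add_mul, ← Matrix.mul_add, Matrix.conjTranspose_add]
    congr 3
    abel
  map_smul' c X := by
    rw [Matrix.conjTranspose_smul, star_trivial, ← smul_add, Matrix.mul_smul, Matrix.smul_mul,
      smul_comm, RingHom.id_apply]

theorem compressRe_apply (P X : Matrix n n ℂ) :
    compressRe P X = (1 / 2 : ℝ) • (P * (X + Xᴴ) * P) := rfl

theorem compressRe_of_isHermitian {P X : Matrix n n ℂ} (hX : X.IsHermitian) :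
    compressRe P X = P * X * P := by
  rw [compressRe_apply, hX.eq, ← two_smul ℝ X, Matrix.mul_smul, Matrix.smul_mul, smul_smul]
  norm_num

theorem mul_mul_eq_self [DecidableEq n] {P X : Matrix n n ℂ} (hP : P.IsHermitian)
    (hX : X.IsHermitian) (h : X * (1 - P) = 0) : P * X * P = X := by
  rw [Matrix.mul_sub, Matrix.mul_one, sub_eq_zero] at h
  have h' : P * X = X := by
    have := congrArg Matrix.conjTranspose h
    rw [Matrix.conjTranspose_mul, hP.eq, hX.eq] at this
    exact this.symm
  rw [h', ← h]

/-- Conic duality with attained dual optimum, for a convex set `S` of positive semidefinite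
matrices: either `T` is separated from the supports of `S`, or the optimal weight `l` with
`T ≤ l Y`, `Y ∈ S`, is the value of a positive functional that is at most `1` on `S`. -/
theorem exists_dual_witness [DecidableEq n] {S : Set (Matrix n n ℂ)} (hne : S.Nonempty)
    (hconv : Convex ℝ S) (hpos : ∀ X ∈ S, X.PosSemidef) {T : Matrix n n ℂ} (hT : T.PosSemidef)
    (hT0 : T ≠ 0) :
    (∃ W : Matrix n n ℂ, W.PosSemidef ∧ 0 < (W * T).trace.re ∧ ∀ X ∈ S, (W * X).trace.re = 0) ∨
    ((dominationWeights id S T).Nonempty ∧ ∃ W : Matrix n n ℂ, W.PosSemidef ∧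
      (W * T).trace.re = sInf (dominationWeights id S T) ∧ ∀ X ∈ S, (W * X).trace.re ≤ 1) := by
  obtain ⟨E, hE, hmax⟩ := exists_maximal_support hne hconv hpos
  obtain ⟨P, c, hP, hPP, hEP, hc, hEc⟩ := exists_support_projection (hpos E hE)
  have hQh : (1 - P)ᴴ = 1 - P := by rw [Matrix.conjTranspose_sub, Matrix.conjTranspose_one, hP.eq]
  have hQQ : (1 - P) * (1 - P) = 1 - P := by
    rw [Matrix.mul_sub, Matrix.mul_one, Matrix.sub_mul, Matrix.one_mul, hPP]; simp
  have hQ : (1 - P).PosSemidef := by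
    have := Matrix.posSemidef_conjTranspose_mul_self (1 - P)
    rwa [hQh, hQQ] at this
  have hSQ : ∀ X ∈ S, X * (1 - P) = 0 := fun X hX => mul_eq_zero_of_ker_le (hmax X hX) hEP
  -- This asks whether `T` is supported where `E`, and hence all of `S`, is supported.
  by_cases hTQ : T * (1 - P) = 0
  · right
    have hTP : compressRe P T = T := by
      rw [compressRe_of_isHermitian hT.1, mul_mul_eq_self hP hT.1 hTQ]
    have hdom : dominationWeights (compressRe P) S T = dominationWeights id S T := by
      simp only [dominationWeights, hTP, id]
    -- Finiteness of the gauge: `X + Xᴴ ≤ t • 1` compresses to a bound by `t • P`, and `c • P ≤ E`.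
    have hfin : ∀ X, (dominationWeights (compressRe P) S X).Nonempty := by
      intro X
      obtain ⟨t, ht, h⟩ := exists_smul_one_sub_posSemidef (X := X + Xᴴ)
        (by rw [Matrix.IsHermitian]; simp [add_comm])
      refine ⟨1 / 2 * t / c, by positivity, E, hE, ?_⟩
      have h1 := posSemidef_smul_real hEc (t := 1 / 2 * t / c) (by positivity)
      have h2 := posSemidef_smul_real (h.conjTranspose_mul_mul_same P) (t := 1 / 2) (by positivity)
      convert h1.add h2 using 1
      rw [compressRe_apply, hP.eq, Matrix.mul_sub, Matrix.sub_mul, Matrix.mul_smul,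
        Matrix.smul_mul, Matrix.mul_one, hPP, smul_sub, smul_sub, smul_smul, smul_smul,
        div_mul_cancel₀ _ hc.ne']
      abel
    obtain ⟨g, hgT, hg⟩ := exists_functional_of_dominationWeights hconv hfin hT0
    obtain ⟨W, hW⟩ := exists_trace_representation g
    -- If the compression of `X` is nonpositive, weight `0` is admissible. This makes `g`
    -- nonnegative on positive matrices and zero on skew-Hermitian ones, which `compressRe` kills.
    have hzero : ∀ X, (-compressRe P X).PosSemidef → g X ≤ 0 := fun X hX =>
      (hg X).trans (csInf_le (bddBelow_dominationWeights _ _ _)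
        ⟨le_rfl, E, hE, by rwa [zero_smul, zero_sub]⟩)
    have hWpos : W.PosSemidef := by
      refine posSemidef_of_functional (fun X hX => ?_) fun X hX => ?_
      · rw [← hW, ← neg_nonpos, ← map_neg]
        refine hzero _ ?_
        rw [map_neg, neg_neg, compressRe_of_isHermitian hX.1]
        simpa only [hP.eq] using hX.conjTranspose_mul_mul_same P
      · have h0 : compressRe P X = 0 := by rw [compressRe_apply, hX]; simp
        rw [← hW]
        refine le_antisymm (hzero X (by rw [h0, neg_zero]; exact Matrix.PosSemidef.zero)) ?_
        rw [← neg_nonpos, ← map_neg]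
        exact hzero _ (by rw [map_neg, h0, neg_zero, neg_zero]; exact Matrix.PosSemidef.zero)
    refine ⟨hdom ▸ hfin T, W, hWpos, by rw [← hW, hgT, hdom], fun X hX => ?_⟩
    rw [← hW]
    -- Members of `S` equal their own compression, so `Y = X` shows that weight `1` is admissible.
    refine (hg X).trans (csInf_le (bddBelow_dominationWeights _ _ _) ⟨zero_le_one, X, hX, ?_⟩)
    rw [compressRe_of_isHermitian (hpos X hX).1, mul_mul_eq_self hP (hpos X hX).1 (hSQ X hX),
      one_smul, sub_self]
    exact Matrix.PosSemidef.zero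
  · left
    refine ⟨1 - P, hQ, ?_, fun X hX => ?_⟩
    · refine lt_of_le_of_ne (re_trace_mul_nonneg hQ hT) fun h0 => hTQ ?_
      obtain ⟨Y, rfl⟩ := exists_eq_conjTranspose_mul_self hT
      -- With `T = Yᴴ * Y`, the pairing of `1 - P` with `T` is the squared Hilbert–Schmidt norm of
      -- `Y * (1 - P)`.
      have h1 : ((Y * (1 - P)) * (Y * (1 - P))ᴴ).trace.re ≤ 0 := by
        rw [Matrix.conjTranspose_mul, hQh, Matrix.mul_assoc, ← Matrix.mul_assoc (1 - P), hQQ,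
          Matrix.trace_mul_comm, Matrix.mul_assoc]
        exact h0.ge
      have h2 := PosSemidef.eq_zero_of_re_trace (Matrix.posSemidef_self_mul_conjTranspose _) h1
      rw [Matrix.self_mul_conjTranspose_eq_zero] at h2
      rw [Matrix.mul_assoc, h2, Matrix.mul_zero]
    · rw [Matrix.trace_mul_comm, hSQ X hX]
      simp

end Compression

/-! ### The Choi correspondence -/

section Choi

variable {A B : Type}

theorem idTensor_apply {R : Type} (Φ : Superop A B) (X : Matrix (R × A) (R × A) ℂ)
    (i j : R × B) :
    idTensor R Φ X i j = Φ (Matrix.of fun a a' => X (i.1, a) (j.1, a')) i.2 j.2 := rfl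

theorem idTensor_sub {R : Type} (Φ Ψ : Superop A B) :
    idTensor R (Φ - Ψ) = idTensor R Φ - idTensor R Ψ := rfl

theorem idTensor_smul {R : Type} (r : ℝ) (Φ : Superop A B) :
    idTensor R (r • Φ) = r • idTensor R Φ := rfl

theorem superop_map_smul_real {A B : Type} (Φ : Superop A B) (r : ℝ) (X : Matrix A A ℂ) :
    Φ (r • X) = r • Φ X :=
  map_smul (Φ.restrictScalars ℝ) r X

section

variable [DecidableEq A]

theorem choi_sub (Φ Ψ : Superop A B) : choi (Φ - Ψ) = choi Φ - choi Ψ := rfl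

theorem choi_add (Φ Ψ : Superop A B) : choi (Φ + Ψ) = choi Φ + choi Ψ := rfl

theorem choi_smul (r : ℝ) (Φ : Superop A B) : choi (r • Φ) = r • choi Φ := rfl

variable [Fintype A]

theorem apply_eq_sum_choi (Φ : Superop A B) (X : Matrix A A ℂ) (b b' : B) :
    Φ X b b' = ∑ a, ∑ a', X a a' * choi Φ (a, b) (a', b') := by
  have h : ∀ a a', Matrix.single a a' (X a a') = X a a' • Matrix.single a a' (1 : ℂ) := by
    intro a a'
    simp [Matrix.smul_single]
  conv_lhs => rw [Matrix.matrix_eq_sum_single X]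
  simp only [h, map_sum, map_smul, Matrix.sum_apply, Matrix.smul_apply, smul_eq_mul]
  rfl

theorem choi_injective : Function.Injective (choi : Superop A B → _) := by
  intro Φ Ψ h
  ext X b b'
  rw [apply_eq_sum_choi, h, ← apply_eq_sum_choi]

/-- The map with a given Choi matrix. -/
def ofChoi : Matrix (A × B) (A × B) ℂ →ₗ[ℝ] Superop A B where
  toFun C :=
    { toFun := fun X => Matrix.of fun b b' => ∑ a, ∑ a', X a a' * C (a, b) (a', b')
      map_add' := fun X Y => by
        ext b b'
        simp [add_mul, Finset.sum_add_distrib]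
      map_smul' := fun c X => by
        ext b b'
        simp [mul_assoc, Finset.mul_sum] }
  map_add' C D := by
    ext X b b'
    simp [mul_add, Finset.sum_add_distrib]
  map_smul' r C := by
    ext X b b'
    simp [Finset.mul_sum, mul_left_comm]

omit [DecidableEq A] in
theorem ofChoi_apply (C : Matrix (A × B) (A × B) ℂ) (X : Matrix A A ℂ) (b b' : B) :
    ofChoi C X b b' = ∑ a, ∑ a', X a a' * C (a, b) (a', b') := rfl

theorem ofChoi_choi (Φ : Superop A B) : ofChoi (choi Φ) = Φ := by
  ext X b b'
  rw [ofChoi_apply, ← apply_eq_sum_choi]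

theorem choi_ofChoi (C : Matrix (A × B) (A × B) ℂ) : choi (ofChoi C) = C := by
  ext ⟨a, b⟩ ⟨a', b'⟩
  change ofChoi C (Matrix.single a a' 1) b b' = _
  rw [ofChoi_apply, Finset.sum_eq_single a, Finset.sum_eq_single a']
  · simp
  · intro x _ hx
    simp [hx.symm]
  · simp
  · intro x _ hx
    simp [hx.symm]
  · simp

theorem idTensor_eq_sum_choi {R : Type} (Φ : Superop A B) (X : Matrix (R × A) (R × A) ℂ)
    (i j : R × B) :
    idTensor R Φ X i j =
      ∑ a, ∑ a', X (i.1, a) (j.1, a') * choi Φ (a, i.2) (a', j.2) := by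
  rw [idTensor_apply, apply_eq_sum_choi]
  rfl

end

theorem IsCP.choi_posSemidef [Fintype A] [DecidableEq A] {Φ : Superop A B} (h : IsCP Φ) :
    (choi Φ).PosSemidef := by
  -- The unnormalised maximally entangled vector: `Φ` applied to half of it gives the Choi matrix.
  let ψ : A × A → ℂ := fun i => if i.1 = i.2 then 1 else 0
  suffices hψ : choi Φ = idTensor A Φ (Matrix.vecMulVec ψ (star ψ)) by
    rw [hψ]
    exact h A _ (Matrix.posSemidef_vecMulVec_self_star ψ)
  ext ⟨a, b⟩ ⟨a', b'⟩
  rw [idTensor_apply]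
  refine congrFun (congrFun (congrArg Φ ?_) b) b'
  ext x y
  by_cases h1 : a = x <;> by_cases h2 : a' = y <;>
    simp [ψ, Matrix.vecMulVec_apply, h1, h2]

/-- Choi's theorem. -/
theorem isCP_of_choi_posSemidef [Fintype A] [DecidableEq A] [Fintype B] {Φ : Superop A B}
    (h : (choi Φ).PosSemidef) : IsCP Φ := by
  intro R _ X hX
  classical
  -- `J` contracts the two copies of `A`, which exhibits the output as a congruence of `X ⊗ choi Φ`.
  let J : Matrix ((R × A) × (A × B)) (R × B) ℂ :=
    Matrix.of fun k i => if k.1.1 = i.1 ∧ k.1.2 = k.2.1 ∧ k.2.2 = i.2 then 1 else 0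
  suffices hJ : idTensor R Φ X = Jᴴ * Matrix.kroneckerMap (fun x y => x * y) X (choi Φ) * J by
    rw [hJ]
    exact (hX.kronecker h).conjTranspose_mul_mul_same J
  ext ⟨r, b⟩ ⟨s, b'⟩
  have hL : ∀ (M : Matrix ((R × A) × (A × B)) ((R × A) × (A × B)) ℂ),
      (Jᴴ * M * J) (r, b) (s, b') =
        ∑ a', ∑ a, M ((r, a), (a, b)) ((s, a'), (a', b')) := by
    intro M
    have h1 : ∀ k, (Jᴴ * M) (r, b) k = ∑ a, M ((r, a), (a, b)) k := by
      intro k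
      rw [Matrix.mul_apply, Fintype.sum_prod_type, Fintype.sum_prod_type, Finset.sum_eq_single r]
      · refine Finset.sum_congr rfl fun a _ => ?_
        rw [Finset.sum_eq_single (a, b)]
        · simp [J]
        · rintro ⟨x, y⟩ _ hxy
          have : ¬ (a = x ∧ y = b) := by rintro ⟨rfl, rfl⟩; exact hxy rfl
          simp [J, this]
        · simp
      · intro x _ hx
        simp [J, hx]
      · simp
    rw [Matrix.mul_apply, Fintype.sum_prod_type, Fintype.sum_prod_type, Finset.sum_eq_single s]
    · refine Finset.sum_congr rfl fun a _ => ?_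
      rw [Finset.sum_eq_single (a, b'), h1]
      · simp [J]
      · rintro ⟨x, y⟩ _ hxy
        have : ¬ (a = x ∧ y = b') := by rintro ⟨rfl, rfl⟩; exact hxy rfl
        simp [J, this]
      · simp
    · intro x _ hx
      simp [J, hx]
    · simp
  rw [idTensor_eq_sum_choi, hL, Finset.sum_comm]
  rfl

theorem isCP_iff_choi_posSemidef [Fintype A] [DecidableEq A] [Fintype B] {Φ : Superop A B} :
    IsCP Φ ↔ (choi Φ).PosSemidef :=
  ⟨IsCP.choi_posSemidef, isCP_of_choi_posSemidef⟩

theorem trace_choi [Fintype A] [DecidableEq A] [Fintype B] {Φ : Superop A B}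
    (h : ∀ X : Matrix A A ℂ, (Φ X).trace = X.trace) : (choi Φ).trace = Fintype.card A := by
  have : ∀ a : A, (Φ (Matrix.single a a 1)).trace = 1 := fun a => by
    rw [h]; simp
  rw [Matrix.trace, Fintype.sum_prod_type]
  calc _ = ∑ a : A, (Φ (Matrix.single a a 1)).trace := rfl
    _ = _ := by simp [this]

end Choi

/-! ### Robustness as a domination weight of Choi matrices -/

section Robustness

variable {A B : Type} [Fintype A] [DecidableEq A] [Fintype B]

theorem isCP_smul_sub_of_mem_robustnessSet {Θ : Superop A B} {F : Set (Superop A B)} {x : ℝ≥0∞}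
    (hx : x ∈ robustnessSet Θ F) :
    ∃ r : ℝ, 0 ≤ r ∧ x = ENNReal.ofReal r ∧ ∃ Φ ∈ F, IsCP ((1 + r) • Φ - Θ) := by
  obtain ⟨r, hr, rfl, Λ, hΛ, hF⟩ := hx
  refine ⟨r, hr, rfl, _, hF, ?_⟩
  have h1 : (1 + r) ≠ 0 := by positivity
  rw [smul_inv_smul₀ h1, add_sub_cancel_left, isCP_iff_choi_posSemidef, choi_smul]
  exact posSemidef_smul_real hΛ.cp.choi_posSemidef hr

/-- The noise is `Λ = r⁻¹ • ((1 + r) • Φ - Θ)`, trace preserving since `(1 + r) - 1 = r`; dividing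
requires `r ≠ 0`. -/
theorem robustness_le_of_isCP {Θ : Superop A B} {F : Set (Superop A B)} (hΘ : IsChannel Θ)
    {r : ℝ} (hr : 0 < r) {Φ : Superop A B} (hΦF : Φ ∈ F) (hΦ : IsChannel Φ)
    (h : IsCP ((1 + r) • Φ - Θ)) : robustness Θ F ≤ ENNReal.ofReal r := by
  refine sInf_le ⟨r, hr.le, rfl, r⁻¹ • ((1 + r) • Φ - Θ), ⟨?_, fun X => ?_⟩, ?_⟩
  · rw [isCP_iff_choi_posSemidef, choi_smul]
    exact posSemidef_smul_real h.choi_posSemidef (inv_nonneg.mpr hr.le)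
  · change (r⁻¹ • ((1 + r) • Φ X - Θ X)).trace = _
    rw [Matrix.trace_smul, Matrix.trace_sub, Matrix.trace_smul, hΦ.trace_eq, hΘ.trace_eq,
      add_smul, one_smul, add_sub_cancel_left, inv_smul_smul₀ hr.ne']
  · rw [smul_inv_smul₀ hr.ne', add_sub_cancel, inv_smul_smul₀ (by positivity)]
    exact hΦF

/-- Compare traces: both Choi matrices have trace `card A`. -/
theorem one_le_of_mem_dominationWeights [Nonempty A] {Θ : Superop A B} {F : Set (Superop A B)}
    (hF : ∀ Φ ∈ F, IsChannel Φ) (hΘ : IsChannel Θ) {l : ℝ}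
    (hl : l ∈ dominationWeights id (choi '' F) (choi Θ)) : 1 ≤ l := by
  obtain ⟨-, -, ⟨Φ, hΦ, rfl⟩, h⟩ := hl
  have := re_trace_nonneg h
  rw [Matrix.trace_sub, Matrix.trace_smul, id, trace_choi (hF Φ hΦ).trace_eq,
    trace_choi hΘ.trace_eq] at this
  simp only [Complex.sub_re, Complex.smul_re, Complex.natCast_re, smul_eq_mul] at this
  have hpos : (0 : ℝ) < Fintype.card A := by exact_mod_cast Fintype.card_pos
  by_contra hlt
  nlinarith

theorem one_add_robustness_le [Nonempty A] {Θ : Superop A B} {F : Set (Superop A B)}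
    (hF : ∀ Φ ∈ F, IsChannel Φ) (hΘ : IsChannel Θ)
    (hne : (dominationWeights id (choi '' F) (choi Θ)).Nonempty) :
    1 + robustness Θ F ≤ ENNReal.ofReal (sInf (dominationWeights id (choi '' F) (choi Θ))) := by
  refine ENNReal.le_of_forall_pos_le_add fun ε hε _ => ?_
  obtain ⟨l, hl, hlt⟩ := exists_lt_of_csInf_lt hne
    (lt_add_of_pos_right (sInf (dominationWeights id (choi '' F) (choi Θ)))
      (NNReal.coe_pos.mpr hε))
  have h1 := one_le_of_mem_dominationWeights hF hΘ hl
  obtain ⟨h0, -, ⟨Φ, hΦ, rfl⟩, h⟩ := hl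
  -- Passing to `l' > l ≥ 1` makes the weight `l' - 1` strictly positive, as `robustness_le_of_isCP`
  -- demands.
  set l' := sInf (dominationWeights id (choi '' F) (choi Θ)) + ε
  have hcp : IsCP ((1 + (l' - 1)) • Φ - Θ) := by
    rw [isCP_iff_choi_posSemidef, choi_sub, choi_smul]
    convert h.add (posSemidef_smul_real (hF Φ hΦ).cp.choi_posSemidef (sub_nonneg.mpr hlt.le))
      using 1
    rw [sub_smul, id, add_sub_cancel]
    abel
  calc 1 + robustness Θ F ≤ 1 + ENNReal.ofReal (l' - 1) := by
        gcongr
        exact robustness_le_of_isCP hΘ (by linarith) hΦ (hF Φ hΦ) hcp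
    _ = ENNReal.ofReal l' := by
        rw [← ENNReal.ofReal_one, ← ENNReal.ofReal_add zero_le_one (by linarith), add_sub_cancel]
    _ ≤ _ := by
        refine ENNReal.ofReal_add_le.trans ?_
        rw [ENNReal.ofReal_coe_nnreal]

/-- An optimal dual witness for the generalised robustness. -/
theorem exists_robustness_witness [DecidableEq B] [Nonempty A] {Θ : Superop A B}
    {F : Set (Superop A B)} (hne : F.Nonempty) (hconv : Convex ℝ F)
    (hF : ∀ Φ ∈ F, IsChannel Φ) (hΘ : IsChannel Θ) :
    ∃ W : Matrix (A × B) (A × B) ℂ, W.PosSemidef ∧ 0 < (W * choi Θ).trace.re ∧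
      ∀ Φ ∈ F, (1 + robustness Θ F) * ENNReal.ofReal (W * choi Φ).trace.re ≤
        ENNReal.ofReal (W * choi Θ).trace.re := by
  have hconv' : Convex ℝ (choi '' F) := by
    rintro _ ⟨Φ, hΦ, rfl⟩ _ ⟨Ψ, hΨ, rfl⟩ a b ha hb hab
    exact ⟨_, hconv hΦ hΨ ha hb hab, rfl⟩
  have h0 : choi Θ ≠ 0 := by
    intro h
    have := trace_choi hΘ.trace_eq
    rw [h, Matrix.trace_zero] at this
    exact Fintype.card_ne_zero (α := A) (by exact_mod_cast this.symm)
  rcases exists_dual_witness (hne.image choi) hconv'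
    (by rintro _ ⟨Φ, hΦ, rfl⟩; exact (hF Φ hΦ).cp.choi_posSemidef) hΘ.cp.choi_posSemidef h0 with
    ⟨W, hW, hpos, hzero⟩ | ⟨hfin, W, hW, heq, hle⟩
  -- Here the robustness may be `⊤`; the inequality survives because `⊤ * 0 = 0` in `ℝ≥0∞`.
  · refine ⟨W, hW, hpos, fun Φ hΦ => ?_⟩
    rw [hzero _ ⟨Φ, hΦ, rfl⟩]
    simp
  · refine ⟨W, hW, ?_, fun Φ hΦ => ?_⟩
    · rw [heq]
      exact one_pos.trans_le
        (le_csInf hfin fun l hl => one_le_of_mem_dominationWeights hF hΘ hl)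
    · rw [heq]
      calc _ ≤ ENNReal.ofReal (sInf (dominationWeights id (choi '' F) (choi Θ))) *
            ENNReal.ofReal 1 :=
            mul_le_mul' (one_add_robustness_le hF hΘ hfin)
              (ENNReal.ofReal_le_ofReal (hle _ ⟨Φ, hΦ, rfl⟩))
        _ = _ := by simp

end Robustness

/-! ### Upper bound: domination propagates through the circuit -/

theorem IsCP.posSemidef_apply {A B : Type} {Φ : Superop A B} (h : IsCP Φ) {X : Matrix A A ℂ}
    (hX : X.PosSemidef) : (Φ X).PosSemidef :=
  (h Unit _ (hX.submatrix Prod.snd)).submatrix (fun b => ((), b))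

theorem fin_prod_Iio_succ {m : ℕ} {M : Type*} [CommMonoid M] (c : Fin (m + 1) → M) (k : Fin m) :
    ∏ i ∈ Finset.Iio k.succ, c i = (∏ i ∈ Finset.Iio k.castSucc, c i) * c k.castSucc := by
  have : Finset.Iio k.succ = insert k.castSucc (Finset.Iio k.castSucc) := by
    ext i
    simp only [Finset.mem_Iio, Finset.mem_insert, Fin.lt_def, Fin.ext_iff, Fin.val_succ,
      Fin.val_castSucc]
    omega
  rw [this, Finset.prod_insert (by simp), mul_comm]

theorem fin_prod_univ_eq_Iio_last {m : ℕ} {M : Type*} [CommMonoid M] (c : Fin (m + 1) → M) :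
    ∏ i, c i = (∏ i ∈ Finset.Iio (Fin.last m), c i) * c (Fin.last m) := by
  have : (Finset.univ : Finset (Fin (m + 1))) = insert (Fin.last m) (Finset.Iio (Fin.last m)) := by
    ext i
    simp only [Finset.mem_Iio, Finset.mem_insert, Fin.lt_def, Fin.ext_iff, Fin.val_last,
      Finset.mem_univ, true_iff]
    omega
  rw [this, Finset.prod_insert (by simp), mul_comm]

namespace BranchEnsemble

variable {m : ℕ} {A B : Fin (m + 1) → Type}
  [∀ k, Fintype (A k)] [∀ k, Fintype (B k)] [∀ k, DecidableEq (B k)]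

theorem stateBefore_zero (G : BranchEnsemble A B) (Λ : ∀ k, Superop (A k) (B k)) :
    G.stateBefore Λ 0 = G.state := rfl

theorem stateBefore_succ (G : BranchEnsemble A B) (Λ : ∀ k, Superop (A k) (B k)) (k : Fin m) :
    G.stateBefore Λ k.succ =
      G.chan k (idTensor (G.Anc k.castSucc) (Λ k.castSucc) (G.stateBefore Λ k.castSucc)) := rfl

theorem stateBefore_posSemidef (G : BranchEnsemble A B) {Λ : ∀ k, Superop (A k) (B k)}
    (hΛ : ∀ k, IsCP (Λ k)) (k : Fin (m + 1)) : (G.stateBefore Λ k).PosSemidef := by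
  induction k using Fin.induction with
  | zero => exact G.state_pos
  | succ k ih => exact (G.chan_isChannel k).cp.posSemidef_apply (hΛ _ _ _ ih)

/-- Up to `id ⊗ ·`, the difference is `C • (c • Ψ - Φ) Y + Φ (C • Y - X)`, a sum of two positive
terms. -/
theorem idTensor_mono {R A B : Type} [Fintype R] {Φ Ψ : Superop A B} {X Y : Matrix (R × A) (R × A) ℂ}
    {c C : ℝ} (hC : 0 ≤ C) (hΦ : IsCP Φ) (hΨ : IsCP (c • Ψ - Φ)) (hY : Y.PosSemidef)
    (hXY : (C • Y - X).PosSemidef) :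
    ((C * c) • idTensor R Ψ Y - idTensor R Φ X).PosSemidef := by
  have h1 := posSemidef_smul_real (hΨ R Y hY) hC
  have h2 := hΦ R _ hXY
  convert h1.add h2 using 1
  rw [map_sub, superop_map_smul_real, idTensor_sub, idTensor_smul, LinearMap.sub_apply,
    LinearMap.smul_apply, smul_sub, smul_smul]
  abel

theorem stateBefore_mono (G : BranchEnsemble A B) {Λ Ψ : ∀ k, Superop (A k) (B k)}
    {c : Fin (m + 1) → ℝ} (hc : ∀ k, 0 ≤ c k) (hΛ : ∀ k, IsCP (Λ k)) (hΨ : ∀ k, IsCP (Ψ k))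
    (h : ∀ k, IsCP (c k • Ψ k - Λ k)) (k : Fin (m + 1)) :
    ((∏ i ∈ Finset.Iio k, c i) • G.stateBefore Ψ k - G.stateBefore Λ k).PosSemidef := by
  induction k using Fin.induction with
  | zero =>
    have : Finset.Iio (0 : Fin (m + 1)) = ∅ := by ext; simp
    rw [this, Finset.prod_empty, one_smul, stateBefore_zero, stateBefore_zero, sub_self]
    exact Matrix.PosSemidef.zero
  | succ k ih =>
    rw [fin_prod_Iio_succ, stateBefore_succ, stateBefore_succ, ← superop_map_smul_real, ← map_sub]
    exact (G.chan_isChannel k).cp.posSemidef_apply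
      (idTensor_mono (Finset.prod_nonneg fun i _ => hc i) (hΛ _) (h _)
        (G.stateBefore_posSemidef hΨ _) ih)

/-- Dominating every slot by a multiple of a completely positive map bounds the success
probability by the product of the multiples. -/
theorem successProb_le_prod_mul (G : BranchEnsemble A B) {Λ Ψ : ∀ k, Superop (A k) (B k)}
    {c : Fin (m + 1) → ℝ} (hc : ∀ k, 0 ≤ c k) (hΛ : ∀ k, IsCP (Λ k)) (hΨ : ∀ k, IsCP (Ψ k))
    (h : ∀ k, IsCP (c k • Ψ k - Λ k)) :
    G.successProb Λ ≤ (∏ k, c k) * G.successProb Ψ := by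
  rw [successProb, successProb, Finset.mul_sum]
  refine Finset.sum_le_sum fun j _ => ?_
  rw [mul_left_comm]
  refine mul_le_mul_of_nonneg_left ?_ (G.p_nonneg j)
  have := re_trace_mul_nonneg (G.povm_pos j)
    (idTensor_mono (Finset.prod_nonneg fun i _ => hc i) (hΛ _) (h (Fin.last m))
        (G.stateBefore_posSemidef hΨ _) (G.stateBefore_mono hc hΛ hΨ h (Fin.last m)))
  rw [← fin_prod_univ_eq_Iio_last, Matrix.mul_sub, Matrix.trace_sub, Matrix.mul_smul,
    Matrix.trace_smul, Complex.sub_re, Complex.smul_re, smul_eq_mul, sub_nonneg] at this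
  exact this

end BranchEnsemble

/-- Take limits along minimising sequences; finiteness of the limits keeps multiplication
continuous. An empty `S i` has infimum `⊤`, and since the other factors are nonzero the product is
`⊤` as well. -/
theorem le_prod_one_add_sInf {ι : Type*} [Fintype ι] {S : ι → Set ℝ≥0∞} {a : ℝ≥0∞}
    (hS : ∀ i, ∀ x ∈ S i, x ≠ ⊤)
    (h : ∀ x : ι → ℝ≥0∞, (∀ i, x i ∈ S i) → a ≤ ∏ i, (1 + x i)) : a ≤ ∏ i, (1 + sInf (S i)) := by
  by_cases hne : ∀ i, (S i).Nonempty
  · choose u _ hu hmem using fun i => exists_seq_tendsto_sInf (hne i) (OrderBot.bddBelow _)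
    refine ge_of_tendsto' (ENNReal.tendsto_finsetProd_of_ne_top Finset.univ
      (fun i _ => tendsto_const_nhds.add (hu i)) fun i _ => ?_)
      fun n => h (fun i => u i n) fun i => hmem i n
    obtain ⟨x, hx⟩ := hne i
    exact ENNReal.add_ne_top.mpr
      ⟨ENNReal.one_ne_top, ne_top_of_le_ne_top (hS i x hx) (sInf_le hx)⟩
  · push Not at hne
    obtain ⟨i, hi⟩ := hne
    have : ∏ i, (1 + sInf (S i)) = ⊤ := by
      classical
      rw [← Finset.mul_prod_erase _ _ (Finset.mem_univ i), hi, sInf_empty, add_top,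
        ENNReal.top_mul]
      exact Finset.prod_ne_zero_iff.mpr fun j _ => by simp
    rw [this]
    exact le_top

theorem BranchEnsemble.advantage_le {m : ℕ} {A B : Fin (m + 1) → Type}
    [∀ k, Fintype (A k)] [∀ k, DecidableEq (A k)] [∀ k, Fintype (B k)] [∀ k, DecidableEq (B k)]
    (G : BranchEnsemble A B) {F : ∀ k, Set (Superop (A k) (B k))}
    {Θ : ∀ k, Superop (A k) (B k)} (hF : ∀ k, ∀ Φ ∈ F k, IsChannel Φ)
    (hΘ : ∀ k, IsChannel (Θ k)) :
    G.advantage F Θ ≤ ∏ k, (1 + robustness (Θ k) (F k)) := by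
  refine le_prod_one_add_sInf ?_ fun x hx => ?_
  · rintro i _ ⟨r, -, rfl, -⟩
    exact ENNReal.ofReal_ne_top
  · choose r hr hxr Φ hΦ hcp using fun k => isCP_smul_sub_of_mem_robustnessSet (hx k)
    refine ENNReal.div_le_of_le_mul ?_
    have h1 : ∀ k, 0 ≤ 1 + r k := fun k => by linarith [hr k]
    calc ENNReal.ofReal (G.successProb Θ)
        ≤ ENNReal.ofReal ((∏ k, (1 + r k)) * G.successProb Φ) :=
          ENNReal.ofReal_le_ofReal (G.successProb_le_prod_mul h1 (fun k => (hΘ k).cp)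
            (fun k => (hF k _ (hΦ k)).cp) hcp)
      _ = (∏ k, (1 + x k)) * ENNReal.ofReal (G.successProb Φ) := by
          rw [ENNReal.ofReal_mul (Finset.prod_nonneg fun k _ => h1 k),
            ENNReal.ofReal_prod_of_nonneg fun k _ => h1 k]
          congr 1
          refine Finset.prod_congr rfl fun k _ => ?_
          rw [ENNReal.ofReal_add zero_le_one (hr k), ENNReal.ofReal_one, hxr]
      _ ≤ _ := by
          gcongr
          exact le_iSup₂_of_le Φ hΦ le_rfl

/-! ### Lower bound: sequential tests of the witnesses -/

theorem trace_mul_nonneg {n : Type*} [Fintype n] {X Y : Matrix n n ℂ} (hX : X.PosSemidef)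
    (hY : Y.PosSemidef) : 0 ≤ (X * Y).trace := by
  classical
  obtain ⟨Z, rfl⟩ := exists_eq_conjTranspose_mul_self hX
  rw [Matrix.mul_assoc, Matrix.trace_mul_comm]
  exact (hY.mul_mul_conjTranspose_same Z).trace_nonneg

section MeasurePrepare

variable {R S : Type} [Fintype R] [DecidableEq R]

/-- Measure the effect `E`; prepare `σ` if it occurs and `τ` otherwise. -/
def measurePrepare (E : Matrix R R ℂ) (σ τ : Matrix S S ℂ) : Superop R S where
  toFun X := (E * X).trace • σ + ((1 - E) * X).trace • τ
  map_add' X Y := by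
    simp only [Matrix.mul_add, Matrix.trace_add, add_smul]
    abel
  map_smul' c X := by
    simp only [Matrix.mul_smul, Matrix.trace_smul, smul_add, smul_smul, smul_eq_mul,
      RingHom.id_apply]

theorem measurePrepare_apply (E : Matrix R R ℂ) (σ τ : Matrix S S ℂ) (X : Matrix R R ℂ) :
    measurePrepare E σ τ X = (E * X).trace • σ + ((1 - E) * X).trace • τ := rfl

theorem isChannel_measurePrepare [Fintype S] {E : Matrix R R ℂ} {σ τ : Matrix S S ℂ} (hE : E.PosSemidef)
    (hE' : (1 - E).PosSemidef) (hσ : σ.PosSemidef) (hτ : τ.PosSemidef) (hσt : σ.trace = 1)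
    (hτt : τ.trace = 1) : IsChannel (measurePrepare E σ τ) := by
  refine ⟨?_, fun X => ?_⟩
  · rw [isCP_iff_choi_posSemidef]
    -- The transpose appears because `tr (E |i⟩⟨j|)` is the entry `E j i`.
    have : choi (measurePrepare E σ τ) = Matrix.kroneckerMap (fun x y => x * y) Eᵀ σ +
        Matrix.kroneckerMap (fun x y => x * y) (1 - E)ᵀ τ := by
      ext ⟨i, s⟩ ⟨j, t⟩
      simp only [choi, Matrix.of_apply, measurePrepare_apply, Matrix.add_apply, Matrix.smul_apply,
        Matrix.kroneckerMap_apply, Matrix.transpose_apply, smul_eq_mul]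
      rw [Matrix.trace_mul_single, Matrix.trace_mul_single]
      simp
    rw [this]
    exact (hE.transpose.kronecker hσ).add (hE'.transpose.kronecker hτ)
  · rw [measurePrepare_apply, Matrix.trace_add, Matrix.trace_smul, Matrix.trace_smul, hσt, hτt,
      smul_eq_mul, smul_eq_mul, mul_one, mul_one, ← Matrix.trace_add, ← Matrix.add_mul]
    simp

end MeasurePrepare

section Sequential

variable {m : ℕ} {A B : Fin (m + 1) → Type}
  [∀ k, Fintype (A k)] [∀ k, Fintype (B k)] [∀ k, DecidableEq (B k)]

/-- Slot by slot tests: slot `k` is probed with `σ k` and the effect `E k`; after a failed test the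
remaining slots receive `τ k`. -/
def sequentialEnsemble (Anc : Fin (m + 1) → Type) [∀ k, Fintype (Anc k)]
    [∀ k, DecidableEq (Anc k)] (E : ∀ k, Matrix (Anc k × B k) (Anc k × B k) ℂ)
    (σ τ : ∀ k, Matrix (Anc k × A k) (Anc k × A k) ℂ) (hE : ∀ k, (E k).PosSemidef)
    (hE' : ∀ k, (1 - E k).PosSemidef) (hσ : ∀ k, (σ k).PosSemidef) (hτ : ∀ k, (τ k).PosSemidef)
    (hσt : ∀ k, (σ k).trace = 1) (hτt : ∀ k, (τ k).trace = 1) : BranchEnsemble A B where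
  N := 2
  p := ![1, 0]
  p_nonneg := by simp [Fin.forall_fin_two]
  p_sum := by simp
  Anc := Anc
  state := σ 0
  state_pos := hσ 0
  state_trace := hσt 0
  chan k := measurePrepare (E k.castSucc) (σ k.succ) (τ k.succ)
  chan_isChannel k := isChannel_measurePrepare (hE _) (hE' _) (hσ _) (hτ _) (hσt _) (hτt _)
  povm := ![E (Fin.last m), 1 - E (Fin.last m)]
  povm_pos := by
    rw [Fin.forall_fin_two]
    exact ⟨hE _, hE' _⟩
  povm_sum := by simp

/-- The hypothesis `hΛ` says that `τ k` never passes the test. The state before slot `k` is thus `σ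
k`, weighted by the product of the earlier pass values, plus a multiple of `τ k` that never
contributes. Only outcome `0` carries prior weight. -/
theorem successProb_sequentialEnsemble (Anc : Fin (m + 1) → Type) [∀ k, Fintype (Anc k)]
    [∀ k, DecidableEq (Anc k)] (E : ∀ k, Matrix (Anc k × B k) (Anc k × B k) ℂ)
    (σ τ : ∀ k, Matrix (Anc k × A k) (Anc k × A k) ℂ) (hE : ∀ k, (E k).PosSemidef)
    (hE' : ∀ k, (1 - E k).PosSemidef) (hσ : ∀ k, (σ k).PosSemidef) (hτ : ∀ k, (τ k).PosSemidef)
    (hσt : ∀ k, (σ k).trace = 1) (hτt : ∀ k, (τ k).trace = 1) (Λ : ∀ k, Superop (A k) (B k))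
    (hΛ : ∀ k, (E k * idTensor (Anc k) (Λ k) (τ k)).trace = 0) :
    (sequentialEnsemble Anc E σ τ hE hE' hσ hτ hσt hτt).successProb Λ =
      (∏ k, (E k * idTensor (Anc k) (Λ k) (σ k)).trace).re := by
  set G := sequentialEnsemble Anc E σ τ hE hE' hσ hτ hσt hτt
  let t : Fin (m + 1) → ℂ := fun k => (E k * idTensor (Anc k) (Λ k) (σ k)).trace
  have hstep : ∀ k, ∀ X : Matrix (Anc k × A k) (Anc k × A k) ℂ,
      (∃ s : ℂ, X = (∏ i ∈ Finset.Iio k, t i) • σ k + s • τ k) →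
      (E k * idTensor (Anc k) (Λ k) X).trace = (∏ i ∈ Finset.Iio k, t i) * t k := by
    rintro k X ⟨s, rfl⟩
    rw [map_add, map_smul, map_smul, Matrix.mul_add, Matrix.mul_smul, Matrix.mul_smul,
      Matrix.trace_add, Matrix.trace_smul, Matrix.trace_smul, hΛ]
    simp [t]
  have hst : ∀ k : Fin (m + 1),
      ∃ s : ℂ, G.stateBefore Λ k = (∏ i ∈ Finset.Iio k, t i) • σ k + s • τ k := by
    intro k
    induction k using Fin.induction with
    | zero =>
      have : Finset.Iio (0 : Fin (m + 1)) = ∅ := by ext; simp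
      refine ⟨0, ?_⟩
      rw [this, Finset.prod_empty, one_smul, zero_smul, add_zero]
      rfl
    | succ k ih =>
      refine ⟨((1 - E k.castSucc) * idTensor (Anc k.castSucc) (Λ k.castSucc)
        (G.stateBefore Λ k.castSucc)).trace, ?_⟩
      rw [fin_prod_Iio_succ, ← hstep _ _ ih]
      rfl
  have h0 : G.branch (0 : Fin 2) Λ = (∏ k, t k).re := by
    rw [fin_prod_univ_eq_Iio_last, ← hstep _ _ (hst _)]
    rfl
  change ∑ j : Fin 2, ![(1 : ℝ), 0] j * G.branch j Λ = _
  rw [Fin.sum_univ_two]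
  simpa using h0

end Sequential

section Probe

theorem submatrix_eq_mul_mul {n k : Type*} [Fintype k] [DecidableEq k] (f : n → k)
    (Y : Matrix k k ℂ) :
    Y.submatrix f f = ((1 : Matrix k k ℂ).submatrix id f)ᴴ * Y * (1 : Matrix k k ℂ).submatrix id f := by
  ext i j
  simp [Matrix.mul_apply, Matrix.one_apply]

/-- A positive semidefinite matrix on `n`, transported to a larger index set and scaled, becomes an
effect. -/
theorem exists_effect {n k : Type*} [Fintype n] [Fintype k] [DecidableEq k] (f : n → k)
    {W : Matrix n n ℂ} (hW : W.PosSemidef) :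
    ∃ (E : Matrix k k ℂ) (c : ℝ), 0 < c ∧ E.PosSemidef ∧ (1 - E).PosSemidef ∧
      ∀ Y : Matrix k k ℂ, (E * Y).trace = c • (W * Y.submatrix f f).trace := by
  set J := (1 : Matrix k k ℂ).submatrix id f
  have hJ := hW.mul_mul_conjTranspose_same J
  obtain ⟨t, ht, h⟩ := exists_smul_one_sub_posSemidef hJ.1
  -- `t` bounds the transported `W` from above, so division by `t` leaves an operator below `1`.
  refine ⟨t⁻¹ • (J * W * Jᴴ), t⁻¹, by positivity, posSemidef_smul_real hJ (by positivity), ?_,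
    fun Y => ?_⟩
  · convert posSemidef_smul_real h (t := t⁻¹) (by positivity) using 1
    rw [smul_sub, inv_smul_smul₀ ht.ne']
  · rw [Matrix.smul_mul, Matrix.trace_smul, submatrix_eq_mul_mul, Matrix.mul_assoc, Matrix.mul_assoc,
      Matrix.trace_mul_comm]
    simp only [Matrix.mul_assoc]
    rfl

variable {A : Type} [Fintype A] [DecidableEq A]

/-- The unnormalised maximally entangled vector of `A` and its copy in `Option A`. -/
def entangledVec (A : Type) [DecidableEq A] : Option A × A → ℂ :=
  fun i => if i.1 = some i.2 then 1 else 0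

/-- The maximally entangled state of `A` and its copy in `Option A`. -/
def entangledState (A : Type) [Fintype A] [DecidableEq A] :
    Matrix (Option A × A) (Option A × A) ℂ :=
  (Fintype.card A : ℝ)⁻¹ • Matrix.vecMulVec (entangledVec A) (star (entangledVec A))

theorem entangledState_posSemidef : (entangledState A).PosSemidef :=
  posSemidef_smul_real (Matrix.posSemidef_vecMulVec_self_star _) (by positivity)

theorem entangledState_trace [Nonempty A] : (entangledState A).trace = 1 := by
  rw [entangledState, Matrix.trace_smul, Matrix.trace_vecMulVec, dotProduct,
    Fintype.sum_prod_type_right]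
  simp [entangledVec]

theorem idTensor_entangledState_submatrix {B : Type} (Λ : Superop A B) :
    (idTensor (Option A) Λ (entangledState A)).submatrix (Prod.map some id) (Prod.map some id) =
      (Fintype.card A : ℝ)⁻¹ • choi Λ := by
  ext ⟨a, b⟩ ⟨a', b'⟩
  rw [← choi_smul]
  simp only [Matrix.submatrix_apply, Prod.map_apply, id, idTensor_apply, choi, Matrix.of_apply,
    LinearMap.smul_apply]
  rw [← superop_map_smul_real]
  refine congrFun (congrFun (congrArg Λ ?_) b) b'
  ext x y
  by_cases h1 : a = x <;> by_cases h2 : a' = y <;>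
    simp [entangledState, entangledVec, Matrix.vecMulVec_apply, h1, h2]

/-- A state on the failure flag `none`. -/
def flagState (a : A) : Matrix (Option A × A) (Option A × A) ℂ :=
  Matrix.vecMulVec (Pi.single (none, a) 1) (star (Pi.single (none, a) 1))

theorem flagState_posSemidef (a : A) : (flagState a).PosSemidef :=
  Matrix.posSemidef_vecMulVec_self_star _

theorem flagState_trace (a : A) : (flagState a).trace = 1 := by
  rw [flagState, Matrix.trace_vecMulVec]
  simp

omit [Fintype A] in
theorem idTensor_flagState_submatrix {B : Type} (Λ : Superop A B) (a : A) :
    (idTensor (Option A) Λ (flagState a)).submatrix (Prod.map some id) (Prod.map some id) = 0 := by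
  ext ⟨x, b⟩ ⟨y, b'⟩
  simp only [Matrix.submatrix_apply, Prod.map_apply, id, idTensor_apply]
  have : (Matrix.of fun a₁ a₂ => flagState a (some x, a₁) (some y, a₂)) = 0 := by
    ext a₁ a₂
    simp [flagState, Matrix.vecMulVec_apply]
  rw [this, map_zero]
  rfl

end Probe

/-- Any product of positive witnesses is, up to a positive factor, the success probability of an
ensemble. -/
theorem exists_ensemble_of_witnesses {m : ℕ} {A B : Fin (m + 1) → Type}
    [∀ k, Fintype (A k)] [∀ k, DecidableEq (A k)] [∀ k, Nonempty (A k)]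
    [∀ k, Fintype (B k)] [∀ k, DecidableEq (B k)]
    {W : ∀ k, Matrix (A k × B k) (A k × B k) ℂ} (hW : ∀ k, (W k).PosSemidef) :
    ∃ (G : BranchEnsemble A B) (c : Fin (m + 1) → ℝ), (∀ k, 0 < c k) ∧
      ∀ Λ : ∀ k, Superop (A k) (B k), (∀ k, IsChannel (Λ k)) →
        G.successProb Λ = ∏ k, (c k * (W k * choi (Λ k)).trace.re) := by
  -- The effect sees only the `some` block of the ancilla: there the entangled state yields the Choi
  -- matrix, while the flag state on `none` yields zero.
  choose E c hc hE hE' htr using fun k =>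
    exists_effect (Prod.map some id : A k × B k → Option (A k) × B k) (hW k)
  refine ⟨sequentialEnsemble (fun k => Option (A k)) E (fun k => entangledState (A k))
    (fun k => flagState (Classical.arbitrary (A k))) hE hE' (fun k => entangledState_posSemidef)
    (fun k => flagState_posSemidef _) (fun k => entangledState_trace) (fun k => flagState_trace _),
    fun k => c k * (Fintype.card (A k) : ℝ)⁻¹, fun k => ?_, fun Λ hΛ => ?_⟩
  · have := hc k
    have : 0 < Fintype.card (A k) := Fintype.card_pos
    positivity
  · rw [successProb_sequentialEnsemble]
    · have : ∀ k, (E k * idTensor (Option (A k)) (Λ k) (entangledState (A k))).trace =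
          ((c k * (Fintype.card (A k) : ℝ)⁻¹ * (W k * choi (Λ k)).trace.re : ℝ) : ℂ) := by
        intro k
        have h0 := Complex.le_def.mp (trace_mul_nonneg (hW k) (hΛ k).cp.choi_posSemidef)
        rw [htr, idTensor_entangledState_submatrix, Matrix.mul_smul, Matrix.trace_smul, smul_smul]
        refine Complex.ext ?_ ?_
        · rw [Complex.smul_re, Complex.ofReal_re, smul_eq_mul]
        · rw [Complex.smul_im, Complex.ofReal_im, ← h0.2]
          simp
      rw [Finset.prod_congr rfl fun k _ => this k, ← Complex.ofReal_prod, Complex.ofReal_re]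
    · intro k
      rw [htr, idTensor_flagState_submatrix]
      simp

theorem exists_ensemble_prod_le_advantage {m : ℕ} {A B : Fin (m + 1) → Type}
    [∀ k, Fintype (A k)] [∀ k, DecidableEq (A k)] [∀ k, Nonempty (A k)]
    [∀ k, Fintype (B k)] [∀ k, DecidableEq (B k)]
    {F : ∀ k, Set (Superop (A k) (B k))} {Θ : ∀ k, Superop (A k) (B k)}
    (hne : ∀ k, (F k).Nonempty) (hconv : ∀ k, Convex ℝ (F k))
    (hF : ∀ k, ∀ Φ ∈ F k, IsChannel Φ) (hΘ : ∀ k, IsChannel (Θ k)) :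
    ∃ G : BranchEnsemble A B, ∏ k, (1 + robustness (Θ k) (F k)) ≤ G.advantage F Θ := by
  choose W hW hpos hle using fun k =>
    exists_robustness_witness (hne k) (hconv k) (hF k) (hΘ k)
  obtain ⟨G, c, hc, hG⟩ := exists_ensemble_of_witnesses hW
  have hw : ∀ k Φ, IsChannel Φ → 0 ≤ c k * (W k * choi Φ).trace.re := fun k Φ h =>
    mul_nonneg (hc k).le (re_trace_mul_nonneg (hW k) h.cp.choi_posSemidef)
  refine ⟨G, ?_⟩
  -- A nonzero numerator excludes `0 / 0`, so the ratio bound may be multiplied out even if the free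
  -- value is `0`.
  have hb : ENNReal.ofReal (G.successProb Θ) ≠ 0 := by
    rw [hG Θ hΘ, ENNReal.ofReal_ne_zero_iff]
    exact Finset.prod_pos fun k _ => mul_pos (hc k) (hpos k)
  rw [BranchEnsemble.advantage, ENNReal.le_div_iff_mul_le (Or.inr hb)
    (Or.inr ENNReal.ofReal_ne_top), BranchEnsemble.freeValue, ENNReal.mul_iSup]
  refine iSup_le fun Φ => ?_
  rw [ENNReal.mul_iSup]
  refine iSup_le fun hΦ => ?_
  have hΦc := fun k => hF k _ (hΦ k)
  rw [hG Θ hΘ, hG Φ hΦc, ENNReal.ofReal_prod_of_nonneg fun k _ => hw k _ (hΘ k),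
    ENNReal.ofReal_prod_of_nonneg fun k _ => hw k _ (hΦc k), ← Finset.prod_mul_distrib]
  refine Finset.prod_le_prod' fun k _ => ?_
  rw [ENNReal.ofReal_mul (hc k).le, ENNReal.ofReal_mul (hc k).le, mul_left_comm]
  gcongr
  exact hle k _ (hΦ k)

/-! ### Compactness and attainment -/

theorem isClosed_setOf_posSemidef {n : Type*} [Fintype n] :
    IsClosed {X : Matrix n n ℂ | X.PosSemidef} := by
  simp only [Matrix.posSemidef_iff_dotProduct_mulVec, Matrix.IsHermitian, Complex.le_def,
    Set.ofPred_and, Set.ofPred_forall]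
  have hc : ∀ v : n → ℂ, Continuous fun X : Matrix n n ℂ => star v ⬝ᵥ X.mulVec v := fun v =>
    continuous_const.dotProduct (continuous_id.matrix_mulVec continuous_const)
  refine (isClosed_eq continuous_id.matrix_conjTranspose continuous_id).inter
    (isClosed_iInter fun v => (isClosed_le continuous_const ?_).inter
      (isClosed_eq continuous_const ?_))
  · exact Complex.continuous_re.comp (hc v)
  · exact Complex.continuous_im.comp (hc v)

/-- Writing `X` as a Gram matrix, the inequality of arithmetic and geometric means bounds an entry
by the mean of two diagonal entries. Fixed trace therefore bounds the Choi matrices of channels. -/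
theorem norm_apply_le_re_trace {n : Type*} [Fintype n] {X : Matrix n n ℂ} (hX : X.PosSemidef)
    (i j : n) : ‖X i j‖ ≤ X.trace.re := by
  classical
  obtain ⟨Y, rfl⟩ := exists_eq_conjTranspose_mul_self hX
  have htr : (Yᴴ * Y).trace.re = ∑ i, ∑ k, ‖Y k i‖ ^ 2 := by
    simp only [Matrix.trace, Matrix.diag, Matrix.mul_apply, Matrix.conjTranspose_apply,
      Complex.re_sum]
    refine Finset.sum_congr rfl fun i _ => Finset.sum_congr rfl fun k _ => ?_
    rw [Complex.star_def, Complex.conj_mul', ← Complex.ofReal_pow, Complex.ofReal_re]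
  have hs : ∀ i, ∑ k, ‖Y k i‖ ^ 2 ≤ (Yᴴ * Y).trace.re := fun i => by
    rw [htr]
    exact Finset.single_le_sum (f := fun i => ∑ k, ‖Y k i‖ ^ 2)
      (fun i _ => Finset.sum_nonneg fun k _ => by positivity) (Finset.mem_univ i)
  calc ‖(Yᴴ * Y) i j‖ ≤ ∑ k, ‖star (Y k i) * Y k j‖ := norm_sum_le _ _
    _ ≤ ∑ k, (1 / 2 * ‖Y k i‖ ^ 2 + 1 / 2 * ‖Y k j‖ ^ 2) := by
        refine Finset.sum_le_sum fun k _ => ?_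
        rw [norm_mul, norm_star]
        nlinarith [sq_nonneg (‖Y k i‖ - ‖Y k j‖)]
    _ = 1 / 2 * ∑ k, ‖Y k i‖ ^ 2 + 1 / 2 * ∑ k, ‖Y k j‖ ^ 2 := by
        rw [Finset.sum_add_distrib, Finset.mul_sum, Finset.mul_sum]
    _ ≤ _ := by linarith [hs i, hs j]

section Channels

variable {A B : Type} [Fintype A] [DecidableEq A]

theorem choi_image_eq_preimage (F : Set (Superop A B)) : choi '' F = ofChoi ⁻¹' F := by
  ext C
  refine ⟨?_, fun h => ⟨_, h, choi_ofChoi C⟩⟩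
  rintro ⟨Φ, hΦ, rfl⟩
  rwa [Set.mem_preimage, ofChoi_choi]

variable [Fintype B]

/-- The Choi matrices of channels form a compact set. -/
theorem isCompact_choi_channels : IsCompact (choi '' {Φ : Superop A B | IsChannel Φ}) := by
  have hball : IsCompact (X := Matrix (A × B) (A × B) ℂ)
      (Set.univ.pi fun _ => Set.univ.pi fun _ => Metric.closedBall (0 : ℂ) (Fintype.card A)) :=
    isCompact_univ_pi (ι := A × B) fun i => isCompact_univ_pi (ι := A × B) fun j =>
      isCompact_closedBall (0 : ℂ) (Fintype.card A)
  refine hball.of_isClosed_subset ?_ ?_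
  · have : choi '' {Φ : Superop A B | IsChannel Φ} = {C | C.PosSemidef} ∩
        ⋂ X : Matrix A A ℂ, {C | (ofChoi C X).trace = X.trace} := by
      ext C
      rw [choi_image_eq_preimage]
      simp only [Set.mem_preimage, Set.mem_ofPred_eq, Set.mem_inter_iff, Set.mem_iInter]
      refine ⟨fun h => ⟨?_, h.trace_eq⟩, fun h => ⟨?_, h.2⟩⟩
      · rw [← choi_ofChoi C]
        exact h.cp.choi_posSemidef
      · rw [isCP_iff_choi_posSemidef, choi_ofChoi]
        exact h.1
    rw [this]
    refine isClosed_setOf_posSemidef.inter (isClosed_iInter fun X => isClosed_eq ?_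
      continuous_const)
    simp only [Matrix.trace, Matrix.diag, ofChoi_apply]
    fun_prop
  · rintro _ ⟨Φ, hΦ, rfl⟩ i - j -
    have := norm_apply_le_re_trace hΦ.cp.choi_posSemidef i j
    rw [trace_choi hΦ.trace_eq, Complex.natCast_re] at this
    simpa using this

theorem convex_channels : Convex ℝ {Φ : Superop A B | IsChannel Φ} := by
  intro Φ hΦ Ψ hΨ a b ha hb hab
  refine ⟨?_, fun X => ?_⟩
  · rw [isCP_iff_choi_posSemidef, choi_add, choi_smul, choi_smul]
    exact (posSemidef_smul_real hΦ.cp.choi_posSemidef ha).add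
      (posSemidef_smul_real hΨ.cp.choi_posSemidef hb)
  · change (a • Φ X + b • Ψ X).trace = _
    rw [Matrix.trace_add, Matrix.trace_smul, Matrix.trace_smul, hΦ.trace_eq, hΨ.trace_eq,
      ← add_smul, hab, one_smul]

theorem robustness_mem_robustnessSet {Θ : Superop A B} {F : Set (Superop A B)}
    (hcl : IsClosed (choi '' F)) (hfin : robustness Θ F ≠ ⊤) :
    robustness Θ F ∈ robustnessSet Θ F := by
  obtain ⟨_, r₀, hr₀, rfl, Λ₀, hΛ₀, h₀⟩ : (robustnessSet Θ F).Nonempty := by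
    by_contra h
    rw [Set.not_nonempty_iff_eq_empty] at h
    exact hfin (by rw [robustness, h, sInf_empty])
  -- Weights above one admissible `r₀` are irrelevant to the infimum, so the minimisation takes
  -- place on a compact set of pairs (weight, Choi matrix of the noise).
  let D : Set (ℝ × Matrix (A × B) (A × B) ℂ) :=
    Set.Icc 0 r₀ ×ˢ (choi '' {Φ : Superop A B | IsChannel Φ})
  let f : ℝ × Matrix (A × B) (A × B) ℂ → Matrix (A × B) (A × B) ℂ :=
    fun z => (1 + z.1)⁻¹ • (choi Θ + z.1 • z.2)
  have hD : IsCompact D := isCompact_Icc.prod isCompact_choi_channels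
  have hf : ContinuousOn f D := by
    have h1 : ContinuousOn (fun z : ℝ × Matrix (A × B) (A × B) ℂ => (1 + z.1)⁻¹) D :=
      (continuous_const.add continuous_fst).continuousOn.inv₀ fun z hz => by
        have : 0 ≤ z.1 := hz.1.1
        exact (add_pos_of_pos_of_nonneg one_pos this).ne'
    exact h1.smul (continuous_const.add (continuous_fst.smul continuous_snd)).continuousOn
  have hQ : IsCompact (D ∩ f ⁻¹' (choi '' F)) :=
    hD.of_isClosed_subset (hf.preimage_isClosed_of_isClosed hD.isClosed hcl)
      Set.inter_subset_left
  obtain ⟨z, ⟨⟨hz1, Λ, hΛ, hz2⟩, Φ, hΦ, hz3⟩, hmin⟩ := hQ.exists_isMinOn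
    ⟨(r₀, choi Λ₀), ⟨⟨hr₀, le_rfl⟩, Λ₀, hΛ₀, rfl⟩, _, h₀, rfl⟩ continuous_fst.continuousOn
  have hmem : ENNReal.ofReal z.1 ∈ robustnessSet Θ F := by
    refine ⟨z.1, hz1.1, rfl, Λ, hΛ, ?_⟩
    have : Φ = (1 + z.1)⁻¹ • (Θ + z.1 • Λ) := choi_injective (by
      rw [hz3, choi_smul, choi_add, choi_smul, hz2])
    rwa [← this]
  have heq : robustness Θ F = ENNReal.ofReal z.1 := by
    refine le_antisymm (sInf_le hmem) (le_sInf ?_)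
    rintro _ ⟨r, hr, rfl, Λ', hΛ', h'⟩
    refine ENNReal.ofReal_le_ofReal ?_
    rcases le_total r r₀ with h | h
    · exact hmin (a := (r, choi Λ')) ⟨⟨⟨hr, h⟩, Λ', hΛ', rfl⟩, _, h', rfl⟩
    · exact hz1.2.trans h
  rwa [heq]

end Channels

theorem continuous_superop_apply {A B : Type} [Fintype A] (Φ : Superop A B) :
    Continuous Φ := by
  classical
  refine continuous_matrix fun b b' => ?_
  simp only [apply_eq_sum_choi Φ]
  fun_prop

theorem continuous_idTensor_ofChoi {Z R A B : Type} [TopologicalSpace Z] [Fintype A]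
    [DecidableEq A] {f : Z → Matrix (A × B) (A × B) ℂ} {g : Z → Matrix (R × A) (R × A) ℂ}
    (hf : Continuous f) (hg : Continuous g) :
    Continuous fun z => idTensor R (ofChoi (f z)) (g z) := by
  refine continuous_matrix fun b b' => ?_
  simp only [idTensor_eq_sum_choi, choi_ofChoi]
  exact continuous_finsetSum _ fun a _ => continuous_finsetSum _ fun a' _ =>
    (hg.matrix_elem _ _).mul (hf.matrix_elem _ _)

namespace BranchEnsemble

variable {m : ℕ} {A B : Fin (m + 1) → Type} [∀ k, Fintype (A k)] [∀ k, DecidableEq (A k)]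
  [∀ k, Fintype (B k)] [∀ k, DecidableEq (B k)]

theorem continuous_successProb (G : BranchEnsemble A B) :
    Continuous fun C : ∀ k, Matrix (A k × B k) (A k × B k) ℂ =>
      G.successProb fun k => ofChoi (C k) := by
  have h : ∀ k, Continuous fun C : ∀ k, Matrix (A k × B k) (A k × B k) ℂ =>
      G.stateBefore (fun k => ofChoi (C k)) k := by
    intro k
    induction k using Fin.induction with
    | zero => exact continuous_const
    | succ k ih =>
      exact (continuous_superop_apply (G.chan k)).comp
        (continuous_idTensor_ofChoi (continuous_apply _) ih)
  refine continuous_finsetSum _ fun j _ => continuous_const.mul (Complex.continuous_re.comp ?_)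
  exact (continuous_const.matrix_mul
    (continuous_idTensor_ofChoi (continuous_apply _) (h _))).matrix_trace

theorem freeMaxAttained (G : BranchEnsemble A B) {F : ∀ k, Set (Superop (A k) (B k))}
    (hne : ∀ k, (F k).Nonempty) (hF : ∀ k, ∀ Φ ∈ F k, IsChannel Φ)
    (hcl : ∀ k, IsClosed (choi '' F k)) : G.FreeMaxAttained F := by
  have hcomp : ∀ k, IsCompact (choi '' F k) := fun k =>
    isCompact_choi_channels.of_isClosed_subset (hcl k) (Set.image_mono (hF k))
  obtain ⟨C, hC, hmax⟩ := (isCompact_univ_pi hcomp).exists_isMaxOn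
    (Set.univ_pi_nonempty_iff.mpr fun k => (hne k).image choi)
    G.continuous_successProb.continuousOn
  refine ⟨fun k => ofChoi (C k), fun k => ?_, fun Ψ hΨ => ?_⟩
  · have : C k ∈ choi '' F k := hC k (Set.mem_univ k)
    rwa [choi_image_eq_preimage] at this
  · have := hmax (a := fun k => choi (Ψ k)) fun k _ => ⟨Ψ k, hΨ k, rfl⟩
    simpa only [Set.mem_ofPred_eq, ofChoi_choi] using this

end BranchEnsemble

/-! ### Free sections of star domains -/

section Star

variable {V : Type*} [AddCommGroup V] [Module ℝ V]

theorem maximal_of_mem_convexComponents {K P : Set V} (hP : P ∈ convexComponents K) :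
    Maximal (fun T : Set V => Convex ℝ T ∧ T ⊆ K) P := hP

/-- Every center of `K` lies in every convex component of `K`. -/
theorem mem_convexComponent_of_mem_kernel {K P : Set V} (hP : P ∈ convexComponents K) {w : V}
    (hw : w ∈ kernel K) : w ∈ P := by
  have hPm := maximal_of_mem_convexComponents hP
  -- The hull of `P` and a center `w` consists of segments from `w` to points of `P`, which stay in
  -- `K`; maximality of `P` then absorbs `w`.
  have hsub : convexHull ℝ (insert w P) ⊆ K := by
    rcases P.eq_empty_or_nonempty with rfl | hne
    · simpa using hw.1
    · rw [convexHull_insert hne, hPm.prop.1.convexHull_eq]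
      intro x hx
      obtain ⟨_, rfl, p, hp, hx⟩ := mem_convexJoin.mp hx
      exact hw.2.segment_subset (hPm.prop.2 hp) hx
  exact hPm.le_of_ge (y := convexHull ℝ (insert w P)) ⟨convex_convexHull ℝ _, hsub⟩
    ((Set.subset_insert w P).trans (subset_convexHull ℝ _))
    (subset_convexHull ℝ _ (Set.mem_insert w P))

theorem freeSections_convex {K C S : Set V} (hS : S ∈ freeSections K C) : Convex ℝ S := by
  obtain ⟨P, -, rfl⟩ := hS
  exact convex_sInter fun Q hQ => (maximal_of_mem_convexComponents hQ.1.1).prop.1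

theorem freeSections_subset {K C S : Set V} (hS : S ∈ freeSections K C) : S ⊆ K := by
  obtain ⟨P, hP, rfl⟩ := hS
  exact fun x hx => (maximal_of_mem_convexComponents hP.1).prop.2 (hx P ⟨hP, rfl⟩)

theorem freeSections_nonempty {K C S : Set V} (hK : IsStarDomain K)
    (hS : S ∈ freeSections K C) : S.Nonempty := by
  obtain ⟨w, hw⟩ := hK
  obtain ⟨P, -, rfl⟩ := hS
  exact ⟨w, fun Q hQ => mem_convexComponent_of_mem_kernel hQ.1.1 hw⟩

/-- The closure of a convex component is convex and still inside the closed set `K`, so by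
maximality the component is closed. -/
theorem isClosed_freeSections [TopologicalSpace V] [IsTopologicalAddGroup V]
    [ContinuousConstSMul ℝ V] {K C S : Set V} (hK : IsClosed K) (hS : S ∈ freeSections K C) :
    IsClosed S := by
  obtain ⟨P, -, rfl⟩ := hS
  refine isClosed_sInter fun Q hQ => ?_
  have hQm := maximal_of_mem_convexComponents hQ.1.1
  have h : closure Q ⊆ Q := hQm.le_of_ge
    ⟨hQm.prop.1.closure, closure_minimal hQm.prop.2 hK⟩ subset_closure
  exact isClosed_of_closure_subset h

end Star

/-! ### Transfer from the real representation to sets of channels -/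

section Representation

variable {A B : Type} [Fintype A] [DecidableEq A] [Fintype B] {d : ℕ}

theorem isClosed_choi_image_representation
    (rep : Superop A B →ᵃ[ℝ] EuclideanSpace ℝ (Fin d)) {S : Set (EuclideanSpace ℝ (Fin d))}
    (hS : IsClosed S) : IsClosed (choi '' {Φ | IsChannel Φ ∧ rep Φ ∈ S}) := by
  -- An affine map on the finite-dimensional space of Choi matrices is continuous, so closedness
  -- pulls back along it.
  have hc : Continuous (rep.comp (ofChoi (A := A) (B := B)).toAffineMap) :=
    (((rep.comp (ofChoi (A := A) (B := B)).toAffineMap).linear.continuous_of_finiteDimensional).add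
      continuous_const).congr fun C =>
        (congrFun (AffineMap.decomp (rep.comp (ofChoi (A := A) (B := B)).toAffineMap)) C).symm
  have : choi '' {Φ | IsChannel Φ ∧ rep Φ ∈ S} = choi '' {Φ : Superop A B | IsChannel Φ} ∩
      (rep.comp (ofChoi (A := A) (B := B)).toAffineMap) ⁻¹' S := by
    simp only [choi_image_eq_preimage]
    rfl
  rw [this]
  exact isCompact_choi_channels.isClosed.inter (hS.preimage hc)

theorem convex_setOf_representation
    (rep : Superop A B →ᵃ[ℝ] EuclideanSpace ℝ (Fin d)) {S : Set (EuclideanSpace ℝ (Fin d))}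
    (hS : Convex ℝ S) : Convex ℝ {Φ | IsChannel Φ ∧ rep Φ ∈ S} :=
  convex_channels.inter (hS.affine_preimage rep)

end Representation

/-- The maximal advantage of branch ensembles is the product of the robustnesses. -/
theorem isGreatest_advantage {m : ℕ} {A B : Fin (m + 1) → Type}
    [∀ k, Fintype (A k)] [∀ k, DecidableEq (A k)] [∀ k, Nonempty (A k)]
    [∀ k, Fintype (B k)] [∀ k, DecidableEq (B k)]
    {F : ∀ k, Set (Superop (A k) (B k))} {Θ : ∀ k, Superop (A k) (B k)}
    (hne : ∀ k, (F k).Nonempty) (hconv : ∀ k, Convex ℝ (F k))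
    (hF : ∀ k, ∀ Φ ∈ F k, IsChannel Φ) (hΘ : ∀ k, IsChannel (Θ k)) :
    IsGreatest (Set.range fun G : BranchEnsemble A B => G.advantage F Θ)
      (∏ k, (1 + robustness (Θ k) (F k))) := by
  obtain ⟨G, hG⟩ := exists_ensemble_prod_le_advantage hne hconv hF hΘ
  refine ⟨⟨G, le_antisymm (G.advantage_le hF hΘ) hG⟩, ?_⟩
  rintro _ ⟨G', rfl⟩
  exact G'.advantage_le hF hΘ

end StarQRT

end

open StarQRT in
/-- The first part treats arbitrary nonempty convex sets `F k` of channels and arbitrary channels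
`Θ k`, one for each slot `k`; for closed sets the maximum over the free channels and the minimum
in the robustness are attained.  The second part is the case of one channel `Θ` in a domain of a
star resource theory: `K` is the compact star domain of free channels in a real linear
representation `rep`, `T` a fortress of `K`, `C` one of its cones, and the `F k` are the free
sections of `C`. -/
theorem theorem2 :
    (∀ (m : ℕ) (A B : Fin (m + 1) → Type)
      [∀ k, Fintype (A k)] [∀ k, DecidableEq (A k)] [∀ k, Nonempty (A k)]
      [∀ k, Fintype (B k)] [∀ k, DecidableEq (B k)]
      (F : ∀ k, Set (Superop (A k) (B k))) (Θ : ∀ k, Superop (A k) (B k)),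
      (∀ k, (F k).Nonempty) → (∀ k, Convex ℝ (F k)) → (∀ k, ∀ Φ ∈ F k, IsChannel Φ) →
      (∀ k, IsChannel (Θ k)) →
      IsGreatest (Set.range fun G : BranchEnsemble A B => G.advantage F Θ)
        (∏ k, (1 + robustness (Θ k) (F k))) ∧
      ((∀ k, IsClosed (choi '' F k)) →
        (∀ G : BranchEnsemble A B, G.FreeMaxAttained F) ∧
        ∀ k, robustness (Θ k) (F k) ≠ ⊤ →
          robustness (Θ k) (F k) ∈ robustnessSet (Θ k) (F k))) ∧
    (∀ (m : ℕ) (A B : Type) [Fintype A] [DecidableEq A] [Nonempty A] [Fintype B] [DecidableEq B]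
      (d : ℕ) (rep : Superop A B →ᵃ[ℝ] EuclideanSpace ℝ (Fin d))
      (K : Set (EuclideanSpace ℝ (Fin d))) (T : Set (Set (EuclideanSpace ℝ (Fin d))))
      (C : Set (EuclideanSpace ℝ (Fin d))) (F : Fin (m + 1) → Set (EuclideanSpace ℝ (Fin d)))
      (Θ : Superop A B),
      Set.InjOn rep {Φ | IsChannel Φ} →
      K ⊆ rep '' {Φ | IsChannel Φ} → IsCompact K → IsStarDomain K → IsFortress K T →
      C ∈ T → Function.Injective F → Set.range F = freeSections K C →
      IsChannel Θ → rep Θ ∈ C ∪ ⋃ k, F k →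
      IsGreatest
        (Set.range fun G : BranchEnsemble (fun _ : Fin (m + 1) => A) (fun _ => B) =>
          G.advantage (fun k => {Φ | IsChannel Φ ∧ rep Φ ∈ F k}) (fun _ => Θ))
        (∏ k, (1 + robustness Θ {Φ | IsChannel Φ ∧ rep Φ ∈ F k})) ∧
      (∀ G : BranchEnsemble (fun _ : Fin (m + 1) => A) (fun _ => B),
        G.FreeMaxAttained fun k => {Φ | IsChannel Φ ∧ rep Φ ∈ F k}) ∧
      ∀ k, robustness Θ {Φ | IsChannel Φ ∧ rep Φ ∈ F k} ≠ ⊤ →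
        robustness Θ {Φ | IsChannel Φ ∧ rep Φ ∈ F k} ∈
          robustnessSet Θ {Φ | IsChannel Φ ∧ rep Φ ∈ F k}) := by
  refine ⟨?_, ?_⟩
  · intro m A B _ _ _ _ _ F Θ hne hconv hF hΘ
    exact ⟨isGreatest_advantage hne hconv hF hΘ, fun hcl =>
      ⟨fun G => G.freeMaxAttained hne hF hcl, fun k => robustness_mem_robustnessSet (hcl k)⟩⟩
  · intro m A B _ _ _ _ _ d rep K T C F Θ _ hKch hK hstar _ _ _ hF hΘ _
    have hmem : ∀ k, F k ∈ freeSections K C := fun k => hF ▸ Set.mem_range_self k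
    -- The star domain has a center, which lies in every free section; since `K` consists of
    -- represented channels, a point of the section lifts to a channel.
    have hne : ∀ k, {Φ | IsChannel Φ ∧ rep Φ ∈ F k}.Nonempty := fun k => by
      obtain ⟨x, hx⟩ := freeSections_nonempty hstar (hmem k)
      obtain ⟨Φ, hΦ, rfl⟩ := hKch (freeSections_subset (hmem k) hx)
      exact ⟨Φ, hΦ, hx⟩
    have hcl : ∀ k, IsClosed (choi '' {Φ | IsChannel Φ ∧ rep Φ ∈ F k}) := fun k =>
      isClosed_choi_image_representation rep (isClosed_freeSections hK.isClosed (hmem k))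
    exact ⟨isGreatest_advantage hne
      (fun k => convex_setOf_representation rep (freeSections_convex (hmem k)))
      (fun _ _ h => h.1) fun _ => hΘ,
      fun G => G.freeMaxAttained hne (fun _ _ h => h.1) hcl,
      fun k => robustness_mem_robustnessSet (hcl k)⟩
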